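/- Let $d>1$. Let $\mathcal M(d)$ be the set of real formal power series in $x^1,\dots,x^d$ of the form $f=\frac1{2!}f_{ij}x^ix^j+\frac1{3!}f_{ijk}x^ix^jx^k+\cdots$ (summation convention) with $(f_{ij})$ symmetric and positive definite, and let $\mathcal V(d)$ be the set of real formal power series $b$ with $b(0)\neq 0$. For $(f,b)\in\mathcal M(d)\times\mathcal V(d)$ put $\tilde f=f-\frac12f_{ij}x^ix^j$ and let $\Lambda_i(f,b)$, $i=0,1,2,\dots$, be the coefficients of the Laplace expansion $$\int_{\mathbb R^d}e^{-nf(x)}b(x)\,dx\;\sim\; n^{-d/2}\bigl\{\Lambda_0(f,b)+\Lambda_1(f,b)n^{-1/2}+\Lambda_2(f,b)n^{-1}+\cdots\bigr\},$$ obtained by Taylor expansion at $0$ and termwise Gaussian integration, that is, $$\Lambda_i(f,b)=\sum_{l\ge 0}\frac{(-1)^l}{l!}\int_{\mathbb R^d}e^{-\frac12 f_{jk}y^jy^k}\,\bigl[\tilde f^{\,l}\,b\bigr]_{i+2l}(y)\,dy,$$ where $[\,\cdot\,]_k$ denotes the homogeneous part of degree $k$ (only the terms with $l\le i$ are non-zero,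 and $\Lambda_i=0$ for odd $i$). Let $\mathcal P(d)$ (the phylon group) be the group, under composition, of formal power series $\psi=(\psi^1,\dots,\psi^d)$ in $x^1,\dots,x^d$ with values in $\mathbb R^d$, without constant term and with invertible linear term. It acts by $$(\psi f)(x)=f(\psi^{-1}(x)),\qquad (\psi b)(x)=b(\psi^{-1}(x))\,\Bigl|\det\Bigl(\tfrac{\partial(\psi^{-1})^i}{\partial x^j}\Bigr)\Bigr|$$ on $\mathcal M(d)$ and $\mathcal V(d)$ respectively, where for a power series $a$ with $a(0)\ne0$, $|a|$ denotes $a$ if $a(0)>0$ and $-a$ if $a(0)<0$. Then for all $(f,b),(g,c)\in\mathcal M(d)\times\mathcal V(d)$, $$\Lambda_i(f,b)=\Lambda_i(g,c)\ \text{ for all } i=0,1,2,\dots$$ if and only if there is a $\psi\in\mathcal P(d)$ with $(f,b)=(\psi g,\psi c)$. -/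

import Mathlib

open MvPowerSeries

noncomputable section

namespace LaplaceExpansion

variable {d : ℕ}

/-- Real formal power series in `d` variables. -/
abbrev FPS (d : ℕ) : Type := MvPowerSeries (Fin d) ℝ

/-- The matrix of second partial derivatives at `0` of a formal power series. -/
def hessian (f : FPS d) : Matrix (Fin d) (Fin d) ℝ :=
  Matrix.of fun i j => constantCoeff (pderiv ℝ i (pderiv ℝ j f))

/-- The formal power series `(1/2!) fᵢⱼ xⁱ xʲ + (1/3!) fᵢⱼₖ xⁱ xʲ xᵏ + ⋯` with `(fᵢⱼ)` positive
definite: no constant term, no linear term, positive-definite Hessian. -/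
def phaseSpace (d : ℕ) : Set (FPS d) :=
  {f | constantCoeff f = 0 ∧ (∀ i, constantCoeff (pderiv ℝ i f) = 0) ∧ (hessian f).PosDef}

/-- The formal power series `b` with `b(0) ≠ 0`. -/
def amplitudeSpace (d : ℕ) : Set (FPS d) :=
  {b | constantCoeff b ≠ 0}

/-! ### Coefficients of the Laplace expansion -/

/-- The series `f - (1/2) fᵢⱼ xⁱ xʲ`. -/
def higherPart (f : FPS d) : FPS d :=
  f - C (1 / 2 : ℝ) * ∑ i, ∑ j, C (hessian f i j) * X i * X j

/-- The value at `x ∈ ℝᵈ` of the homogeneous part of degree `k` of a formal power series. -/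
def homogEval (p : FPS d) (k : ℕ) (x : Fin d → ℝ) : ℝ :=
  ∑ m ∈ Finset.univ.finsuppAntidiag k, coeff m p * ∏ j, x j ^ m j

/-- The coefficient `Λᵢ(f, b)` of `n ^ (-i/2)` in the Laplace expansion
`n ^ (-d/2) * (Λ₀ + Λ₁ n ^ (-1/2) + ⋯)` of `∫ exp(-n f(x)) b(x) dx`. Write `H` for the Hessian and
`f̃` for the higher part of `f`. After the substitution `x = y / √n`, expansion of
`exp(-n f̃) b` in formal powers of `n ^ (-1/2)` gives
`n ^ (-d/2) * ∑ₗ ((-n)ˡ / l!) ∑ₖ n ^ (-k/2) ∫ exp(-yᵀHy/2) (f̃ˡ b)ₖ(y) dy`,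
where `(·)ₖ` is the homogeneous part of degree `k`; the power `n ^ (-i/2)` comes from
`k = i + 2l`. As `f̃ˡ` has no terms of degree below `3l`, only `l ≤ i` contributes. -/
def laplaceCoeff (f b : FPS d) (i : ℕ) : ℝ :=
  ∑ l ∈ Finset.range (i + 1), (-1 : ℝ) ^ l / (Nat.factorial l : ℝ) *
    ∫ y : Fin d → ℝ, Real.exp (-(1 / 2) * (y ⬝ᵥ (hessian f).mulVec y)) *
      homogEval (higherPart f ^ l * b) (i + 2 * l) y

/-! ### The phylon group -/

/-- The matrix of partial derivatives `∂ψⁱ/∂xʲ` of a tuple of formal power series. -/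
def jacobian (ψ : Fin d → FPS d) : Matrix (Fin d) (Fin d) (FPS d) :=
  Matrix.of fun i j => pderiv ℝ j (ψ i)

/-- The matrix `(ψⁱⱼ)` of the linear term of a tuple of formal power series. -/
def linearPart (ψ : Fin d → FPS d) : Matrix (Fin d) (Fin d) ℝ :=
  Matrix.of fun i j => coeff (Finsupp.single j 1) (ψ i)

/-- Elements of the phylon group: `ℝᵈ`-valued formal power series in `d` variables with no
constant term and invertible linear term. -/
@[ext]
structure Phylon (d : ℕ) where
  toFun : Fin d → FPS d
  constantCoeff_toFun : ∀ i, constantCoeff (toFun i) = 0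
  isUnit_linearPart : IsUnit (linearPart toFun)

theorem hasSubst_of_zero {ψ : Fin d → FPS d} (h : ∀ i, constantCoeff (ψ i) = 0) :
    HasSubst ψ := hasSubst_of_constantCoeff_zero h

theorem order_le_order_subst {ψ : Fin d → FPS d} (h : ∀ i, constantCoeff (ψ i) = 0) (f : FPS d) :
    f.order ≤ (subst ψ f).order := by
  refine le_trans ?_ (le_order_subst (hasSubst_of_zero h) f)
  calc f.order = 1 * f.order := (one_mul _).symm
    _ ≤ _ := by
      gcongr
      exact le_iInf fun i => one_le_order_iff_constCoeff_eq_zero.2 (h i)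

theorem coeff_subst_of_lt_order {ψ : Fin d → FPS d} (h : ∀ i, constantCoeff (ψ i) = 0) {f : FPS d}
    {e : Fin d →₀ ℕ} (he : (e.degree : ℕ∞) < f.order) : coeff e (subst ψ f) = 0 :=
  coeff_of_lt_order (he.trans_le (order_le_order_subst h f))

theorem constantCoeff_subst_zero {ψ : Fin d → FPS d} (h : ∀ i, constantCoeff (ψ i) = 0)
    (f : FPS d) : constantCoeff (subst ψ f) = constantCoeff f := by
  have hψ := hasSubst_of_zero h
  have h1 : constantCoeff (subst ψ (f - C (constantCoeff f))) = 0 :=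
    constantCoeff_subst_eq_zero hψ h (by simp)
  rw [subst_sub hψ, subst_C, map_sub, constantCoeff_C, sub_eq_zero] at h1
  exact h1

theorem eq_single_of_degree_eq_one {e : Fin d →₀ ℕ} (h : e.degree = 1) :
    ∃ i, e = Finsupp.single i 1 := by
  have h0 : e ≠ 0 := fun h0 => by simp [h0] at h
  obtain ⟨i, hi⟩ := Finsupp.ne_iff.1 h0
  have hle : Finsupp.single i 1 ≤ e := by
    rw [Finsupp.single_le_iff]
    exact Nat.one_le_iff_ne_zero.2 hi
  obtain ⟨m, rfl⟩ := exists_add_of_le hle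
  rw [map_add, Finsupp.degree_single] at h
  refine ⟨i, ?_⟩
  rw [(Finsupp.degree_eq_zero_iff m).1 (by omega), add_zero]

theorem coeff_single_subst {ψ : Fin d → FPS d} (h : ∀ i, constantCoeff (ψ i) = 0) (f : FPS d)
    (k : Fin d) : coeff (Finsupp.single k 1) (subst ψ f) =
      ∑ j, coeff (Finsupp.single j 1) f * coeff (Finsupp.single k 1) (ψ j) := by
  have hψ := hasSubst_of_zero h
  set l : FPS d := C (constantCoeff f) + ∑ j, coeff (Finsupp.single j 1) f • X j with hl
  have hord : (2 : ℕ∞) ≤ (f - l).order := by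
    refine nat_le_order (n := 2) fun e he => ?_
    rcases Nat.lt_succ_iff_lt_or_eq.1 he with h0 | h0
    · have : e = 0 := (Finsupp.degree_eq_zero_iff e).1 (by omega)
      subst this
      simp [hl]
    · obtain ⟨i, rfl⟩ := eq_single_of_degree_eq_one h0
      simp [hl, coeff_index_single_X, coeff_C, Finsupp.single_eq_zero]
  have h1 : coeff (Finsupp.single k 1) (subst ψ (f - l)) = 0 := by
    refine coeff_subst_of_lt_order h (lt_of_lt_of_le ?_ hord)
    simp
  have h2 : subst ψ l = C (constantCoeff f) + ∑ j, coeff (Finsupp.single j 1) f • ψ j := by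
    rw [hl, subst_add hψ, subst_C, ← coe_substAlgHom hψ, map_sum]
    simp [map_smul, substAlgHom_X hψ]
  rw [subst_sub hψ, h2, map_sub, sub_eq_zero] at h1
  rw [h1]
  simp [coeff_C, Finsupp.single_eq_zero]

theorem linearPart_comp {ψ φ : Fin d → FPS d} (hφ : ∀ i, constantCoeff (φ i) = 0) :
    linearPart (fun i => subst φ (ψ i)) = linearPart ψ * linearPart φ := by
  ext i k
  simp [linearPart, Matrix.mul_apply, coeff_single_subst hφ]

theorem linearPart_X : linearPart (fun i : Fin d => (X i : FPS d)) = 1 := by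
  ext i j
  simp only [linearPart, Matrix.of_apply, coeff_index_single_X, Matrix.one_apply, eq_comm]

/-- A series of order at least `k` changes only in degrees above `k` under a substitution that is
tangent to the identity. -/
theorem succ_order_le_sub_subst {θ : Fin d → FPS d} (h : ∀ i, constantCoeff (θ i) = 0)
    (hlin : ∀ i, (2 : ℕ∞) ≤ (θ i - X i).order) (f : FPS d) (k : ℕ) (hf : (k : ℕ∞) ≤ f.order) :
    ((k + 1 : ℕ) : ℕ∞) ≤ (f - subst θ f).order := by
  have hmul : ∀ (p q : ℕ) (a a' b b' : FPS d), (p : ℕ∞) ≤ a.order → (p : ℕ∞) ≤ a'.order →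
      ((p + 1 : ℕ) : ℕ∞) ≤ (a' - a).order →
      (q : ℕ∞) ≤ b.order → (q : ℕ∞) ≤ b'.order → ((q + 1 : ℕ) : ℕ∞) ≤ (b' - b).order →
      ((p + q : ℕ) : ℕ∞) ≤ (a * b).order ∧ ((p + q : ℕ) : ℕ∞) ≤ (a' * b').order ∧
      ((p + q + 1 : ℕ) : ℕ∞) ≤ (a' * b' - a * b).order := by
    intro p q a a' b b' ha ha' haa hb hb' hbb
    refine ⟨?_, ?_, ?_⟩
    · push_cast
      exact (add_le_add ha hb).trans le_order_mul
    · push_cast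
      exact (add_le_add ha' hb').trans le_order_mul
    · have : a' * b' - a * b = a' * (b' - b) + (a' - a) * b := by ring
      rw [this]
      refine le_trans (le_min ?_ ?_) min_order_le_add
      · refine le_trans ?_ ((add_le_add ha' hbb).trans le_order_mul)
        push_cast; rw [add_assoc]
      · refine le_trans ?_ ((add_le_add haa hb).trans le_order_mul)
        push_cast; rw [add_right_comm]
  have hone : ∀ i, (1 : ℕ∞) ≤ (X i : FPS d).order := fun i =>
    one_le_order_iff_constCoeff_eq_zero.2 (constantCoeff_X i)
  have hpow : ∀ (i : Fin d) (n : ℕ), (n : ℕ∞) ≤ ((X i : FPS d) ^ n).order ∧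
      (n : ℕ∞) ≤ (θ i ^ n).order ∧ ((n + 1 : ℕ) : ℕ∞) ≤ (θ i ^ n - X i ^ n).order := by
    intro i n
    induction n with
    | zero => simp
    | succ n ih =>
      rw [pow_succ, pow_succ]
      exact hmul n 1 _ _ _ _ ih.1 ih.2.1 ih.2.2 (by simpa using hone i)
        (by simpa using one_le_order_iff_constCoeff_eq_zero.2 (h i)) (by simpa using hlin i)
  have hprod : ∀ (m : Fin d →₀ ℕ) (s : Finset (Fin d)),
      ((∑ i ∈ s, m i : ℕ) : ℕ∞) ≤ (∏ i ∈ s, (X i : FPS d) ^ m i).order ∧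
      ((∑ i ∈ s, m i : ℕ) : ℕ∞) ≤ (∏ i ∈ s, θ i ^ m i).order ∧
      ((∑ i ∈ s, m i + 1 : ℕ) : ℕ∞) ≤ (∏ i ∈ s, θ i ^ m i - ∏ i ∈ s, X i ^ m i).order := by
    intro m s
    induction s using Finset.induction_on with
    | empty => simp
    | insert i s hi ih =>
      rw [Finset.prod_insert hi, Finset.prod_insert hi, Finset.sum_insert hi]
      exact hmul _ _ _ _ _ _ (hpow i _).1 (hpow i _).2.1 (hpow i _).2.2 ih.1 ih.2.1 ih.2.2
  refine nat_le_order fun e he => ?_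
  rw [map_sub, sub_eq_zero]
  conv_lhs => rw [← id_eq (a := f), ← subst_self (σ := Fin d) (R := ℝ)]
  rw [coeff_subst HasSubst.X, coeff_subst (hasSubst_of_zero h)]
  refine finsum_congr fun m => ?_
  rcases lt_or_ge m.degree k with hm | hm
  · rw [coeff_of_lt_order (lt_of_lt_of_le (by exact_mod_cast hm) hf), zero_smul, zero_smul]
  · congr 1
    rw [Finsupp.prod_fintype _ _ (by simp), Finsupp.prod_fintype _ _ (by simp), eq_comm,
      ← sub_eq_zero, ← map_sub]
    refine coeff_of_lt_order (lt_of_lt_of_le ?_ (hprod m Finset.univ).2.2)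
    rw [← Finsupp.degree_eq_sum]
    exact_mod_cast (lt_of_lt_of_le he (by omega))

theorem subst_surjective {θ : Fin d → FPS d} (h : ∀ i, constantCoeff (θ i) = 0)
    (hlin : ∀ i, (2 : ℕ∞) ≤ (θ i - X i).order) (p : FPS d) : ∃ q : FPS d, subst θ q = p := by
  have hθ := hasSubst_of_zero h
  let D : ℕ → FPS d := fun n => (fun r => r - subst θ r)^[n] p
  have hD : ∀ n, D (n + 1) = D n - subst θ (D n) := fun n =>
    Function.iterate_succ_apply' _ _ _
  have hDo : ∀ n : ℕ, (n : ℕ∞) ≤ (D n).order := by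
    intro n
    induction n with
    | zero => simp
    | succ n ih => rw [hD]; exact succ_order_le_sub_subst h hlin _ n ih
  have hDs : ∀ N : ℕ, subst θ (∑ n ∈ Finset.range N, D n) = p - D N := by
    intro N
    induction N with
    | zero => rw [Finset.sum_range_zero, ← coe_substAlgHom hθ, map_zero]; exact (sub_self p).symm
    | succ N ih =>
      rw [Finset.sum_range_succ, subst_add hθ, ih, hD]
      abel
  let q : FPS d := fun e => coeff e (∑ n ∈ Finset.range (e.degree + 1), D n)
  have hq : ∀ e, coeff e q = coeff e (∑ n ∈ Finset.range (e.degree + 1), D n) := fun e => rfl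
  have hqo : ∀ N : ℕ, ((N : ℕ) : ℕ∞) ≤ (q - ∑ n ∈ Finset.range N, D n).order := by
    intro N
    refine nat_le_order fun e he => ?_
    rw [map_sub, hq, sub_eq_zero, map_sum, map_sum]
    refine Finset.sum_subset (Finset.range_subset_range.2 he) fun n _ hn => ?_
    refine coeff_of_lt_order (lt_of_lt_of_le ?_ (hDo n))
    simp only [Finset.mem_range, not_lt] at hn
    exact_mod_cast hn
  refine ⟨q, MvPowerSeries.ext fun e => ?_⟩
  have h1 := coeff_subst_of_lt_order h
    (lt_of_lt_of_le (by exact_mod_cast Nat.lt_succ_self e.degree) (hqo (e.degree + 1)))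
  have h2 : coeff e (D (e.degree + 1)) = 0 := coeff_of_lt_order
    (lt_of_lt_of_le (by exact_mod_cast Nat.lt_succ_self e.degree) (hDo (e.degree + 1)))
  rw [subst_sub hθ, hDs, map_sub, map_sub, h2, sub_zero, sub_eq_zero] at h1
  exact h1

theorem exists_left_inverse (ψ : Phylon d) :
    ∃ φ : Fin d → FPS d, ∀ i, subst ψ.toFun (φ i) = X i := by
  have hψ := hasSubst_of_zero ψ.constantCoeff_toFun
  obtain ⟨B, hB⟩ := ψ.isUnit_linearPart.exists_left_inv
  let L : Fin d → FPS d := fun i => ∑ j, B i j • X j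
  have hL0 : ∀ i, constantCoeff (L i) = 0 := fun i => by simp [L]
  have hLl : linearPart L = B := by
    ext i j
    simp [L, linearPart, coeff_index_single_X]
  let θ : Fin d → FPS d := fun i => subst ψ.toFun (L i)
  have hθ0 : ∀ i, constantCoeff (θ i) = 0 := fun i => by
    rw [constantCoeff_subst_zero ψ.constantCoeff_toFun, hL0]
  have hθl : linearPart θ = 1 := by
    rw [linearPart_comp ψ.constantCoeff_toFun, hLl, hB]
  have hθ : ∀ i, (2 : ℕ∞) ≤ (θ i - X i).order := by
    intro i
    refine nat_le_order (n := 2) fun e he => ?_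
    rcases Nat.lt_succ_iff_lt_or_eq.1 he with h0 | h0
    · have : e = 0 := (Finsupp.degree_eq_zero_iff e).1 (by omega)
      subst this
      simp [hθ0]
    · obtain ⟨j, rfl⟩ := eq_single_of_degree_eq_one h0
      have := congrFun (congrFun (hθl.trans linearPart_X.symm) i) j
      simpa [linearPart, sub_eq_zero] using this
  choose q hq using subst_surjective hθ0 hθ
  refine ⟨fun i => subst L (q (X i)), fun i => ?_⟩
  rw [subst_comp_subst_apply (hasSubst_of_zero hL0) hψ]
  exact hq (X i)

namespace Phylon

/-- Composition of formal power series: `(ψ * φ)(x) = ψ(φ(x))`. -/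
instance : Mul (Phylon d) where
  mul ψ φ :=
    { toFun := fun i => subst φ.toFun (ψ.toFun i)
      constantCoeff_toFun := fun i => by
        rw [constantCoeff_subst_zero φ.constantCoeff_toFun, ψ.constantCoeff_toFun]
      isUnit_linearPart := by
        rw [linearPart_comp φ.constantCoeff_toFun]
        exact ψ.isUnit_linearPart.mul φ.isUnit_linearPart }

instance : One (Phylon d) where
  one :=
    { toFun := fun i => X i
      constantCoeff_toFun := fun i => constantCoeff_X i
      isUnit_linearPart := by rw [linearPart_X]; exact isUnit_one }

theorem exists_mul_eq_one (ψ : Phylon d) : ∃ φ : Phylon d, φ * ψ = 1 := by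
  obtain ⟨φ, hφ⟩ := exists_left_inverse ψ
  have h0 : ∀ i, constantCoeff (φ i) = 0 := fun i => by
    rw [← constantCoeff_subst_zero ψ.constantCoeff_toFun, hφ, constantCoeff_X]
  have h1 : linearPart φ * linearPart ψ.toFun = 1 := by
    rw [← linearPart_comp ψ.constantCoeff_toFun, ← linearPart_X]
    simp only [hφ]
  exact ⟨⟨φ, h0, IsUnit.of_mul_eq_one _ h1⟩, Phylon.ext (funext hφ)⟩

/-- The inverse for composition. -/
instance : Inv (Phylon d) where
  inv ψ := (exists_mul_eq_one ψ).choose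

instance : Group (Phylon d) :=
  Group.ofLeftAxioms
    (fun a b c => Phylon.ext (funext fun i =>
      (subst_comp_subst_apply (hasSubst_of_zero b.constantCoeff_toFun)
        (hasSubst_of_zero c.constantCoeff_toFun) (a.toFun i))))
    (fun a => Phylon.ext (funext fun i =>
      subst_X (hasSubst_of_zero a.constantCoeff_toFun) i))
    (fun a => (exists_mul_eq_one a).choose_spec)

/-- For a power series `a` with `a(0) ≠ 0`, the power series `|a|`: `a` if `a(0) > 0`,
and `-a` if `a(0) < 0`. -/
def absSeries (a : FPS d) : FPS d :=
  if 0 < constantCoeff a then a else -a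

/-- The action on functions: `(ψ f)(x) = f(ψ⁻¹(x))`. -/
def actFun (ψ : Phylon d) (f : FPS d) : FPS d :=
  subst (ψ⁻¹).toFun f

/-- The action on densities: `(ψ b)(x) = b(ψ⁻¹(x)) |det (∂(ψ⁻¹)ⁱ/∂xʲ)|`. -/
def actDensity (ψ : Phylon d) (b : FPS d) : FPS d :=
  subst (ψ⁻¹).toFun b * absSeries (jacobian (ψ⁻¹).toFun).det

end Phylon

end LaplaceExpansion

end

open MvPowerSeries

noncomputable section

namespace LaplaceExpansion

variable {d : ℕ}

/-! Invariance is the change of variables formula made formal. A linear change is a genuine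
substitution in each Gaussian integral (`laplaceCoeff_linSubst`). For the shears `Φ_t : xʲ ↦ xʲ + t
u`, the `t`-derivative of the transported integrand `exp(-n f_t) b_t` is the `j`-th partial
derivative of `exp(-n f_t) u (b ∘ Φ_t)`, which Gaussian integration by parts kills
(`gaussLaplace_pderiv`, `laplaceCoeff_shear`). Linear maps and shears generate the phylon group,
whence `Phylon.laplaceCoeff_pull`.

Conversely, every pair can be moved to a normal form `(|x|²/2, β)` with `β` radial, that is, a limit
of polynomials in `|x|²` (`exists_normal_form`). The phase is normalised degree by degree, as in the
Morse lemma. This leaves the freedom to add vector fields tangent to the spheres: to leading order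
they fix `|x|²/2` and change the density by a multiple of their divergence. For `d > 1` these
divergences and the radial series together exhaust each degree (`exists_tangential_divergence`),
because on degree `k` the operator `|x|² Δ` is the scalar `k (k + d - 2)` up to such a divergence,
and this scalar is nonzero for `k ≥ 1`.

On a normal form, `Λᵢ` is the Gaussian integral of the degree `i` part of `β`
(`laplaceCoeff_quadForm_one`). That part is a multiple of a power of `|x|²`, whose integral is
positive, so the coefficients determine `β` (`eq_zero_of_gaussInt_eq_zero`). Pairs with equal
coefficients therefore share a normal form and lie in one orbit. -/

/-! ### The filtration by order -/

/-- The ideal of formal power series of order at least `k`. -/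
def ordIdeal (d k : ℕ) : Ideal (FPS d) where
  carrier := {f | ∀ e : Fin d →₀ ℕ, e.degree < k → coeff e f = 0}
  zero_mem' := by simp
  add_mem' := by
    intro f g hf hg e he
    rw [map_add, hf e he, hg e he, add_zero]
  smul_mem' := by
    intro c f hf e he
    rw [smul_eq_mul, coeff_mul]
    refine Finset.sum_eq_zero fun p hp => ?_
    rw [Finset.HasAntidiagonal.mem_antidiagonal] at hp
    rw [hf p.2 (lt_of_le_of_lt _ he), mul_zero]
    rw [← hp, map_add]
    omega

theorem mem_ordIdeal_iff_le_order {k : ℕ} {f : FPS d} : f ∈ ordIdeal d k ↔ (k : ℕ∞) ≤ f.order :=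
  ⟨fun h => nat_le_order h, fun h _ he =>
    coeff_of_lt_order (lt_of_lt_of_le (by exact_mod_cast he) h)⟩

theorem ordIdeal_anti {k l : ℕ} (h : k ≤ l) {f : FPS d} (hf : f ∈ ordIdeal d l) :
    f ∈ ordIdeal d k := fun e he => hf e (he.trans_le h)

theorem mem_ordIdeal_zero (f : FPS d) : f ∈ ordIdeal d 0 := fun _ he => absurd he (Nat.not_lt_zero _)

theorem mul_mem_ordIdeal {k l : ℕ} {f g : FPS d} (hf : f ∈ ordIdeal d k) (hg : g ∈ ordIdeal d l) :
    f * g ∈ ordIdeal d (k + l) := by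
  rw [mem_ordIdeal_iff_le_order] at *
  push_cast
  exact (add_le_add hf hg).trans le_order_mul

theorem pow_mem_ordIdeal {k : ℕ} {f : FPS d} (hf : f ∈ ordIdeal d k) (n : ℕ) :
    f ^ n ∈ ordIdeal d (n * k) := by
  induction n with
  | zero => exact ordIdeal_anti (by omega) (mem_ordIdeal_zero _)
  | succ n ih =>
    rw [pow_succ, Nat.succ_mul]
    exact mul_mem_ordIdeal ih hf

theorem mem_ordIdeal_one {f : FPS d} : f ∈ ordIdeal d 1 ↔ constantCoeff f = 0 := by
  rw [mem_ordIdeal_iff_le_order, Nat.cast_one, one_le_order_iff_constCoeff_eq_zero]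

theorem X_mem_ordIdeal (i : Fin d) : (X i : FPS d) ∈ ordIdeal d 1 :=
  mem_ordIdeal_one.2 (constantCoeff_X i)

theorem eq_zero_of_forall_mem_ordIdeal {f : FPS d} (h : ∀ k, f ∈ ordIdeal d k) : f = 0 :=
  MvPowerSeries.ext fun e => h (e.degree + 1) e (Nat.lt_succ_self _)

theorem eq_of_forall_sub_mem_ordIdeal {f g : FPS d} (h : ∀ k, f - g ∈ ordIdeal d k) : f = g :=
  sub_eq_zero.1 (eq_zero_of_forall_mem_ordIdeal h)

theorem sub_truncTotal_mem_ordIdeal (f : FPS d) (k : ℕ) :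
    f - (truncTotal k f : MvPolynomial (Fin d) ℝ) ∈ ordIdeal d k := by
  intro e he
  rw [map_sub, MvPolynomial.coeff_coe, coeff_truncTotal _ he, sub_self]

theorem pderiv_mem_ordIdeal {k : ℕ} {f : FPS d} (hf : f ∈ ordIdeal d (k + 1)) (i : Fin d) :
    pderiv ℝ i f ∈ ordIdeal d k := by
  intro e he
  rw [coeff_pderiv, hf _ (by rw [map_add, Finsupp.degree_single]; omega), zero_mul]

theorem mem_ordIdeal_succ_of_pderiv {k : ℕ} {f : FPS d} (h0 : constantCoeff f = 0)
    (h : ∀ i, pderiv ℝ i f ∈ ordIdeal d k) : f ∈ ordIdeal d (k + 1) := by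
  intro e he
  by_cases h1 : e = 0
  · rw [h1, coeff_zero_eq_constantCoeff, h0]
  obtain ⟨i, hi⟩ := Finsupp.ne_iff.1 h1
  have hle : Finsupp.single i 1 ≤ e := by
    rw [Finsupp.single_le_iff]
    exact Nat.one_le_iff_ne_zero.2 hi
  obtain ⟨m, rfl⟩ := exists_add_of_le hle
  rw [map_add, Finsupp.degree_single] at he
  have h2 := h i m (by omega)
  rw [coeff_pderiv, mul_eq_zero, add_comm] at h2
  exact h2.resolve_right (by positivity)

/-! ### Substitution and the filtration -/

section Subst

variable {φ θ : Fin d → FPS d}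

theorem subst_mem_ordIdeal (h : ∀ i, constantCoeff (φ i) = 0) {k : ℕ} {f : FPS d}
    (hf : f ∈ ordIdeal d k) : subst φ f ∈ ordIdeal d k := by
  rw [mem_ordIdeal_iff_le_order] at *
  exact hf.trans (order_le_order_subst h f)

theorem subst_finset_sum (h : ∀ i, constantCoeff (φ i) = 0) {ι : Type*} (s : Finset ι)
    (f : ι → FPS d) : subst φ (∑ i ∈ s, f i) = ∑ i ∈ s, subst φ (f i) := by
  simp only [← coe_substAlgHom (hasSubst_of_zero h), map_sum]

/-- Two additive maps that lose at most one degree and agree on polynomials agree on all formal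
power series. -/
theorem eq_of_eq_on_polynomials (S T : FPS d → FPS d)
    (hS : ∀ f g, S (f - g) = S f - S g) (hT : ∀ f g, T (f - g) = T f - T g)
    (hS' : ∀ k f, f ∈ ordIdeal d (k + 1) → S f ∈ ordIdeal d k)
    (hT' : ∀ k f, f ∈ ordIdeal d (k + 1) → T f ∈ ordIdeal d k)
    (h : ∀ p : MvPolynomial (Fin d) ℝ, S p = T p) (f : FPS d) : S f = T f := by
  refine eq_of_forall_sub_mem_ordIdeal fun k => ?_
  have h1 := hS' k _ (sub_truncTotal_mem_ordIdeal f (k + 1))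
  have h2 := hT' k _ (sub_truncTotal_mem_ordIdeal f (k + 1))
  rw [hS] at h1
  rw [hT, ← h] at h2
  have := sub_mem h1 h2
  rwa [sub_sub_sub_cancel_right] at this

/-- Modulo `ordIdeal d k` the two substitutions are algebra homomorphisms on polynomials that agree
on the variables; the tail of `f` beyond a truncation lands in the ideal under both. -/
theorem subst_sub_subst_mem (hφ : ∀ i, constantCoeff (φ i) = 0)
    (hθ : ∀ i, constantCoeff (θ i) = 0) {k : ℕ} (h : ∀ i, φ i - θ i ∈ ordIdeal d k) (f : FPS d) :
    subst φ f - subst θ f ∈ ordIdeal d k := by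
  have hp : ∀ p : MvPolynomial (Fin d) ℝ,
      subst φ (p : FPS d) - subst θ (p : FPS d) ∈ ordIdeal d k := by
    intro p
    rw [← Ideal.Quotient.eq, subst_coe, subst_coe]
    have hfg : ((Ideal.Quotient.mkₐ ℝ (ordIdeal d k)).comp (MvPolynomial.aeval φ)) =
        (Ideal.Quotient.mkₐ ℝ (ordIdeal d k)).comp (MvPolynomial.aeval θ) := by
      refine MvPolynomial.algHom_ext fun i => ?_
      simpa [Ideal.Quotient.eq] using h i
    exact DFunLike.congr_fun hfg p
  have h1 := subst_mem_ordIdeal hφ (sub_truncTotal_mem_ordIdeal f k)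
  have h2 := subst_mem_ordIdeal hθ (sub_truncTotal_mem_ordIdeal f k)
  rw [subst_sub (hasSubst_of_zero hφ)] at h1
  rw [subst_sub (hasSubst_of_zero hθ)] at h2
  have := add_mem (sub_mem h1 h2) (hp (truncTotal k f))
  convert this using 1
  ring

/-- The chain rule for formal power series. -/
theorem pderiv_subst (h : ∀ i, constantCoeff (φ i) = 0) (i : Fin d) (f : FPS d) :
    pderiv ℝ i (subst φ f) = ∑ j, subst φ (pderiv ℝ j f) * pderiv ℝ i (φ j) := by
  have hφ := hasSubst_of_zero h
  refine eq_of_eq_on_polynomials (fun f => pderiv ℝ i (subst φ f))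
    (fun f => ∑ j, subst φ (pderiv ℝ j f) * pderiv ℝ i (φ j)) ?_ ?_ ?_ ?_ ?_ f
  · intro f g
    simp only [subst_sub hφ, map_sub]
  · intro f g
    simp only [subst_sub hφ, map_sub, sub_mul, Finset.sum_sub_distrib]
  · intro k f hf
    exact pderiv_mem_ordIdeal (subst_mem_ordIdeal h hf) i
  · intro k f hf
    exact sum_mem fun j _ => Ideal.mul_mem_right _ _
      (subst_mem_ordIdeal h (pderiv_mem_ordIdeal hf j))
  · intro p
    induction p using MvPolynomial.induction_on with
    | C a =>
      simp only [MvPolynomial.coe_C, subst_C, pderiv_C, ← coe_substAlgHom hφ, map_zero, zero_mul,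
        Finset.sum_const_zero]
    | add p q hp hq =>
      beta_reduce at hp hq
      simp only [MvPolynomial.coe_add, subst_add hφ, map_add, hp, hq, add_mul,
        Finset.sum_add_distrib]
    | mul_X p j hp =>
      beta_reduce at hp
      simp only [MvPolynomial.coe_mul, MvPolynomial.coe_X, subst_mul hφ, Derivation.leibniz, hp,
        subst_X hφ, smul_eq_mul, subst_add hφ, add_mul, Finset.sum_add_distrib]
      congr 1
      · rw [Finset.sum_eq_single j]
        · rw [pderiv_X_self, ← coe_substAlgHom hφ, map_one, mul_one]
        · intro l _ hl
          rw [pderiv_X_of_ne hl.symm, ← coe_substAlgHom hφ, map_zero, mul_zero, zero_mul]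
        · simp
      · rw [Finset.mul_sum]
        exact Finset.sum_congr rfl fun l _ => by ring

end Subst

/-! ### Hessians -/

/-- The quadratic form `(1/2) Hᵢⱼ xⁱ xʲ`. -/
def quadForm (H : Matrix (Fin d) (Fin d) ℝ) : FPS d :=
  C (1 / 2 : ℝ) * ∑ i, ∑ j, C (H i j) * X i * X j

/-- The linear change of variables `xⁱ ↦ Aⁱⱼ xʲ`. -/
def linSubst (A : Matrix (Fin d) (Fin d) ℝ) (i : Fin d) : FPS d := ∑ j, C (A i j) * X j

theorem constantCoeff_linSubst (A : Matrix (Fin d) (Fin d) ℝ) (i : Fin d) :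
    constantCoeff (linSubst A i) = 0 := by simp [linSubst]

theorem quadForm_eq_sum_linSubst (H : Matrix (Fin d) (Fin d) ℝ) :
    quadForm H = C (1 / 2 : ℝ) * ∑ i, X i * linSubst H i := by
  simp only [quadForm, linSubst, Finset.mul_sum]
  exact Finset.sum_congr rfl fun i _ => Finset.sum_congr rfl fun j _ => by ring

theorem pderiv_linSubst (A : Matrix (Fin d) (Fin d) ℝ) (i j : Fin d) :
    pderiv ℝ j (linSubst A i) = C (A i j) := by
  simp [linSubst, Derivation.leibniz, pderiv_X, Pi.single_apply]

theorem pderiv_quadForm {H : Matrix (Fin d) (Fin d) ℝ} (hH : H.IsSymm) (j : Fin d) :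
    pderiv ℝ j (quadForm H) = linSubst H j := by
  have h1 : ∑ i, X i * C (H i j) = linSubst H j :=
    Finset.sum_congr rfl fun i _ => by rw [hH.apply, mul_comm]
  simp only [quadForm_eq_sum_linSubst, Derivation.leibniz, pderiv_C, map_sum,
    pderiv_linSubst, smul_eq_mul, Finset.sum_add_distrib, h1, pderiv_X]
  rw [Finset.sum_eq_single j (by intro i _ hi; simp [hi]) (by simp)]
  rw [Pi.single_eq_same, mul_one, ← two_mul, ← mul_assoc, show (2 : FPS d) = C (2 : ℝ) from (map_ofNat C 2).symm,
    ← map_mul]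
  norm_num

theorem hessian_quadForm {H : Matrix (Fin d) (Fin d) ℝ} (hH : H.IsSymm) :
    hessian (quadForm H) = H := by
  ext i j
  simp [hessian, pderiv_quadForm hH, pderiv_linSubst, hH.apply]

theorem hessian_sub (f g : FPS d) : hessian (f - g) = hessian f - hessian g := by
  ext i j
  simp [hessian]

theorem hessian_eq_zero {f : FPS d} (hf : f ∈ ordIdeal d 3) : hessian f = 0 := by
  ext i j
  exact mem_ordIdeal_one.1 (pderiv_mem_ordIdeal (pderiv_mem_ordIdeal hf j) i)

theorem linSubst_mem_ordIdeal (A : Matrix (Fin d) (Fin d) ℝ) (i : Fin d) :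
    linSubst A i ∈ ordIdeal d 1 := mem_ordIdeal_one.2 (constantCoeff_linSubst A i)

theorem quadForm_mem_ordIdeal (H : Matrix (Fin d) (Fin d) ℝ) : quadForm H ∈ ordIdeal d 2 := by
  rw [quadForm_eq_sum_linSubst]
  exact Ideal.mul_mem_left _ _ (sum_mem fun i _ =>
    mul_mem_ordIdeal (X_mem_ordIdeal i) (linSubst_mem_ordIdeal H i))

theorem hessian_isSymm {f : FPS d} (hf : f ∈ phaseSpace d) : (hessian f).IsSymm := by
  have := hf.2.2.isHermitian
  rwa [Matrix.IsHermitian, Matrix.conjTranspose_eq_transpose_of_trivial] at this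

theorem sub_quadForm_mem_ordIdeal {f : FPS d} (hf : f ∈ phaseSpace d) :
    f - quadForm (hessian f) ∈ ordIdeal d 3 := by
  have hq := quadForm_mem_ordIdeal (hessian f)
  refine mem_ordIdeal_succ_of_pderiv ?_ fun i => mem_ordIdeal_succ_of_pderiv ?_ fun j =>
    mem_ordIdeal_one.2 ?_
  · rw [map_sub, hf.1, mem_ordIdeal_one.1 (ordIdeal_anti one_le_two hq), sub_zero]
  · rw [map_sub, map_sub, hf.2.1, mem_ordIdeal_one.1 (pderiv_mem_ordIdeal hq i), sub_zero]
  · have : hessian (f - quadForm (hessian f)) j i = 0 := by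
      rw [hessian_sub, hessian_quadForm (hessian_isSymm hf), sub_self, Matrix.zero_apply]
    exact this

/-- This criterion avoids computing second derivatives of composites: the 2-jet of a substituted
phase is read off modulo `ordIdeal d 3`. -/
theorem phaseSpace_and_hessian_eq_of_sub_quadForm {f : FPS d} {H : Matrix (Fin d) (Fin d) ℝ}
    (hH : H.PosDef) (h : f - quadForm H ∈ ordIdeal d 3) : f ∈ phaseSpace d ∧ hessian f = H := by
  have hs : H.IsSymm := by
    have := hH.isHermitian
    rwa [Matrix.IsHermitian, Matrix.conjTranspose_eq_transpose_of_trivial] at this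
  have hh : hessian f = H := by
    have := hessian_eq_zero h
    rwa [hessian_sub, hessian_quadForm hs, sub_eq_zero] at this
  have h2 : f ∈ ordIdeal d 2 := by
    have := add_mem (ordIdeal_anti (by norm_num) h) (quadForm_mem_ordIdeal H)
    rwa [sub_add_cancel] at this
  exact ⟨⟨mem_ordIdeal_one.1 (ordIdeal_anti one_le_two h2),
    fun i => mem_ordIdeal_one.1 (pderiv_mem_ordIdeal h2 i), hh ▸ hH⟩, hh⟩

theorem mem_ordIdeal_two_of_mem_phaseSpace {f : FPS d} (hf : f ∈ phaseSpace d) :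
    f ∈ ordIdeal d 2 := by
  have := add_mem (ordIdeal_anti (by norm_num) (sub_quadForm_mem_ordIdeal hf))
    (quadForm_mem_ordIdeal (hessian f))
  rwa [sub_add_cancel] at this

theorem linSubst_mul (B A : Matrix (Fin d) (Fin d) ℝ) (i : Fin d) :
    linSubst (B * A) i = ∑ j, C (B i j) * linSubst A j := by
  simp only [linSubst, Matrix.mul_apply, map_sum, Finset.mul_sum, Finset.sum_mul, map_mul]
  rw [Finset.sum_comm]
  exact Finset.sum_congr rfl fun i _ => Finset.sum_congr rfl fun j _ => by ring

theorem subst_linSubst (A B : Matrix (Fin d) (Fin d) ℝ) (i : Fin d) :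
    subst (linSubst A) (linSubst B i) = linSubst (B * A) i := by
  have hA := constantCoeff_linSubst A
  conv_lhs => rw [linSubst]
  rw [linSubst_mul]
  simp only [subst_finset_sum hA, subst_mul (hasSubst_of_zero hA), subst_C,
    subst_X (hasSubst_of_zero hA)]

theorem subst_linSubst_quadForm (A H : Matrix (Fin d) (Fin d) ℝ) :
    subst (linSubst A) (quadForm H) = quadForm (A.transpose * H * A) := by
  have hA := constantCoeff_linSubst A
  rw [quadForm_eq_sum_linSubst, subst_mul (hasSubst_of_zero hA), subst_C, subst_finset_sum hA,
    quadForm_eq_sum_linSubst]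
  congr 1
  simp only [subst_mul (hasSubst_of_zero hA), subst_X (hasSubst_of_zero hA), subst_linSubst]
  rw [mul_assoc]
  conv_lhs =>
    enter [2, i]
    rw [linSubst, Finset.sum_mul]
  rw [Finset.sum_comm]
  refine Finset.sum_congr rfl fun k _ => ?_
  rw [linSubst_mul, Finset.mul_sum]
  exact Finset.sum_congr rfl fun i _ => by rw [Matrix.transpose_apply]; ring

/-! ### Gaussian moments -/

/-- The moments `∫ tⁿ exp(-t²/2) dt`. -/
def gaussMoment (n : ℕ) : ℝ := ∫ t : ℝ, t ^ n * Real.exp (-(1 / 2) * t ^ 2)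

theorem integrable_pow_mul_gauss (n : ℕ) :
    MeasureTheory.Integrable fun t : ℝ => t ^ n * Real.exp (-(1 / 2) * t ^ 2) := by
  have := integrable_rpow_mul_exp_neg_mul_sq (b := 1 / 2) (by norm_num) (s := n)
    (by have : (0 : ℝ) ≤ n := n.cast_nonneg
        linarith)
  simpa using this

theorem hasDerivAt_gauss (t : ℝ) :
    HasDerivAt (fun t : ℝ => Real.exp (-(1 / 2) * t ^ 2)) (-(t * Real.exp (-(1 / 2) * t ^ 2))) t := by
  have h := ((hasDerivAt_pow 2 t).const_mul (-(1 / 2) : ℝ)).exp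
  convert h using 1
  push_cast
  ring

theorem gaussMoment_one : gaussMoment 1 = 0 := by
  have h := MeasureTheory.integral_eq_zero_of_hasDerivAt_of_integrable hasDerivAt_gauss
    (by simpa using (integrable_pow_mul_gauss 1).neg) (by simpa using integrable_pow_mul_gauss 0)
  rw [MeasureTheory.integral_neg, neg_eq_zero] at h
  simpa [gaussMoment] using h

theorem gaussMoment_add_two (n : ℕ) : gaussMoment (n + 2) = (n + 1) * gaussMoment n := by
  have hd : ∀ t : ℝ, HasDerivAt (fun t : ℝ => t ^ (n + 1) * Real.exp (-(1 / 2) * t ^ 2))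
      ((n + 1) * (t ^ n * Real.exp (-(1 / 2) * t ^ 2)) -
        t ^ (n + 2) * Real.exp (-(1 / 2) * t ^ 2)) t := by
    intro t
    refine ((hasDerivAt_pow (n + 1) t).mul (hasDerivAt_gauss t)).congr_deriv ?_
    push_cast
    ring
  have h := MeasureTheory.integral_eq_zero_of_hasDerivAt_of_integrable hd
    (((integrable_pow_mul_gauss n).const_mul _).sub (integrable_pow_mul_gauss (n + 2)))
    (integrable_pow_mul_gauss (n + 1))
  rw [MeasureTheory.integral_sub ((integrable_pow_mul_gauss n).const_mul _)
    (integrable_pow_mul_gauss (n + 2)), MeasureTheory.integral_const_mul, sub_eq_zero] at h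
  exact h.symm

theorem gaussMoment_zero_pos : 0 < gaussMoment 0 := by
  have : gaussMoment 0 = √(Real.pi / (1 / 2)) := by
    simp only [gaussMoment, pow_zero, one_mul]
    exact integral_gaussian _
  rw [this]
  positivity

theorem mem_univ_finsuppAntidiag {k : ℕ} {m : Fin d →₀ ℕ} :
    m ∈ Finset.univ.finsuppAntidiag k ↔ m.degree = k := by
  simp [Finsupp.degree_eq_sum]

/-- The Gaussian integral `∫ exp(-|y|²/2) pₖ(y) dy` of the homogeneous part of degree `k`. -/
def gaussInt (k : ℕ) : FPS d →ₗ[ℝ] ℝ :=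
  ∑ m ∈ Finset.univ.finsuppAntidiag k, (∏ i, gaussMoment (m i)) • coeff m

theorem gaussInt_apply (k : ℕ) (p : FPS d) : gaussInt k p =
    ∑ m ∈ Finset.univ.finsuppAntidiag k, (∏ i, gaussMoment (m i)) * coeff m p := by
  simp [gaussInt]

theorem gaussInt_eq_zero {k : ℕ} {p : FPS d} (hp : p ∈ ordIdeal d (k + 1)) : gaussInt k p = 0 := by
  rw [gaussInt_apply]
  refine Finset.sum_eq_zero fun m hm => ?_
  rw [hp m (by rw [mem_univ_finsuppAntidiag.1 hm]; omega), mul_zero]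

theorem gaussInt_zero_one_pos : 0 < gaussInt 0 (1 : FPS d) := by
  simp only [gaussInt_apply, Finset.finsuppAntidiag_zero, Finset.sum_singleton]
  simpa using pow_pos gaussMoment_zero_pos d

theorem integral_gauss_mul_homogEval (p : FPS d) (k : ℕ) :
    ∫ y : Fin d → ℝ, Real.exp (-(1 / 2) * (y ⬝ᵥ (1 : Matrix (Fin d) (Fin d) ℝ).mulVec y)) *
      homogEval p k y = gaussInt k p := by
  have h1 : ∀ (y : Fin d → ℝ), Real.exp (-(1 / 2) * (y ⬝ᵥ (1 : Matrix (Fin d) (Fin d) ℝ).mulVec y)) *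
      homogEval p k y = ∑ m ∈ Finset.univ.finsuppAntidiag k, coeff m p *
        ∏ i, (y i ^ m i * Real.exp (-(1 / 2) * y i ^ 2)) := by
    intro y
    rw [homogEval, Finset.mul_sum]
    refine Finset.sum_congr rfl fun m _ => ?_
    rw [Finset.prod_mul_distrib, ← Real.exp_sum, ← Finset.mul_sum, Matrix.one_mulVec, dotProduct]
    simp only [← sq]
    ring
  simp only [h1]
  rw [MeasureTheory.integral_finsetSum, gaussInt_apply]
  · refine Finset.sum_congr rfl fun m _ => ?_
    rw [MeasureTheory.integral_const_mul, mul_comm,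
      MeasureTheory.integral_fintype_prod_volume_eq_prod
        (fun i t => t ^ m i * Real.exp (-(1 / 2) * t ^ 2))]
    rfl
  · intro m _
    refine MeasureTheory.Integrable.const_mul ?_ _
    exact MeasureTheory.Integrable.fintype_prod (f := fun i t => t ^ m i * Real.exp (-(1 / 2) * t ^ 2))
      fun i => integrable_pow_mul_gauss (m i)

/-- Gaussian integration by parts. -/
theorem gaussInt_X_mul (k : ℕ) (j : Fin d) (p : FPS d) :
    gaussInt (k + 2) (X j * p) = gaussInt k (pderiv ℝ j p) := by
  classical
  set s : Fin d →₀ ℕ := Finsupp.single j 1 with hs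
  have hsd : s.degree = 1 := Finsupp.degree_single j 1
  -- Both sides are reindexed as the same sum over monomials of degree `k + 1`, with the moments
  -- taken after one more factor `xʲ`.
  let w : (Fin d →₀ ℕ) → ℝ := fun n => (∏ i, gaussMoment ((n + s) i)) * coeff n p
  have h1 : gaussInt (k + 2) (X j * p) = ∑ n ∈ Finset.univ.finsuppAntidiag (k + 1), w n := by
    rw [gaussInt_apply]
    symm
    refine Finset.sum_of_injOn (fun n => n + s) (fun _ _ _ _ h => add_right_cancel h) ?_ ?_ ?_
    · intro n hn
      rw [Finset.mem_coe, mem_univ_finsuppAntidiag] at *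
      rw [map_add, hsd, hn]
    · intro m hm hm'
      rw [mem_univ_finsuppAntidiag] at hm
      have : coeff m (X j * p) = 0 := by
        rw [X, coeff_monomial_mul, if_neg]
        intro hle
        obtain ⟨n, rfl⟩ := exists_add_of_le hle
        refine hm' ⟨n, ?_, add_comm _ _⟩
        rw [map_add, Finsupp.degree_single] at hm
        rw [Finset.mem_coe, mem_univ_finsuppAntidiag]
        omega
      rw [this, mul_zero]
    · intro n _
      have : coeff (n + s) (X j * p) = coeff n p := by
        rw [add_comm, X, hs, coeff_add_monomial_mul, one_mul]
      rw [this]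
  have h2 : gaussInt k (pderiv ℝ j p) = ∑ n ∈ Finset.univ.finsuppAntidiag (k + 1), w n := by
    rw [gaussInt_apply]
    refine Finset.sum_of_injOn (fun n => n + s) (fun _ _ _ _ h => add_right_cancel h) ?_ ?_ ?_
    · intro n hn
      rw [Finset.mem_coe, mem_univ_finsuppAntidiag] at *
      rw [map_add, hsd, hn]
    · intro m hm hm'
      rw [mem_univ_finsuppAntidiag] at hm
      -- The monomials free of `xʲ` are lost under differentiation; on the other side they carry the
      -- first moment, which is zero.
      have hm0 : m j = 0 := by
        by_contra h0
        have hle : s ≤ m := by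
          rw [hs, Finsupp.single_le_iff]
          exact Nat.one_le_iff_ne_zero.2 h0
        obtain ⟨n, rfl⟩ := exists_add_of_le hle
        refine hm' ⟨n, ?_, add_comm _ _⟩
        rw [map_add, hsd] at hm
        rw [Finset.mem_coe, mem_univ_finsuppAntidiag]
        omega
      have : ∏ i, gaussMoment ((m + s) i) = 0 := by
        refine Finset.prod_eq_zero (Finset.mem_univ j) ?_
        simp [hs, hm0, gaussMoment_one]
      simp only [w, this, zero_mul]
    · intro n _
      have : ∏ i, gaussMoment ((n + s + s) i) = (n j + 1) * ∏ i, gaussMoment (n i) := by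
        rw [← Finset.mul_prod_erase _ _ (Finset.mem_univ j),
          ← Finset.mul_prod_erase Finset.univ (fun i => gaussMoment (n i)) (Finset.mem_univ j),
          ← mul_assoc, ← gaussMoment_add_two]
        congr 1
        · simp [hs]
        · refine Finset.prod_congr rfl fun i hi => ?_
          simp [hs, (Finset.ne_of_mem_erase hi).symm]
      simp only [w, this, coeff_pderiv]
      ring
  rw [h1, h2]

/-! ### The Laplace expansion at a standard quadratic form -/

/-- The Laplace coefficient of `(|x|²/2 + h, b)`, with the sum over `l` taken up to `N`. -/
def gaussLaplace (N i : ℕ) (h b : FPS d) : ℝ :=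
  ∑ l ∈ Finset.range N, (-1 : ℝ) ^ l / (Nat.factorial l : ℝ) * gaussInt (i + 2 * l) (h ^ l * b)

theorem laplaceCoeff_eq_gaussLaplace {f : FPS d} (hf : hessian f = 1) (b : FPS d) (i : ℕ) :
    laplaceCoeff f b i = gaussLaplace (i + 1) i (f - quadForm 1) b := by
  have : higherPart f = f - quadForm 1 := by rw [higherPart, hf]; rfl
  simp only [laplaceCoeff, gaussLaplace, hf, integral_gauss_mul_homogEval, this]

/-- The series `h ^ l * b` has order at least `3l + s`, which exceeds `i + 2l` once `l > i - s`.
Free truncation levels let the sums be shifted by one during integration by parts. -/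
theorem gaussLaplace_of_le {N M i s : ℕ} {h b : FPS d} (hh : h ∈ ordIdeal d 3)
    (hb : b ∈ ordIdeal d s) (hi : i < N + s) (hNM : N ≤ M) :
    gaussLaplace N i h b = gaussLaplace M i h b := by
  refine Finset.sum_subset (Finset.range_subset_range.2 hNM) fun l _ hl => ?_
  rw [Finset.mem_range, not_lt] at hl
  rw [gaussInt_eq_zero (ordIdeal_anti (by omega) (mul_mem_ordIdeal (pow_mem_ordIdeal hh l) hb)),
    mul_zero]

theorem gaussLaplace_add (N i : ℕ) (h b c : FPS d) :
    gaussLaplace N i h (b + c) = gaussLaplace N i h b + gaussLaplace N i h c := by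
  simp only [gaussLaplace, mul_add, map_add, Finset.sum_add_distrib]

/-- The derivative of `exp(-h)` under the Gaussian integral. -/
theorem sum_gaussInt_natCast_mul_pow_pred (N i : ℕ) (h b : FPS d) :
    ∑ l ∈ Finset.range (N + 1), (-1 : ℝ) ^ l / (Nat.factorial l : ℝ) *
      gaussInt (i + 2 * l) ((l : FPS d) * h ^ (l - 1) * b) = - gaussLaplace N (i + 2) h b := by
  rw [Finset.sum_range_succ', gaussLaplace, ← Finset.sum_neg_distrib]
  simp only [Nat.cast_zero, zero_mul, map_zero, mul_zero, add_zero]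
  refine Finset.sum_congr rfl fun l _ => ?_
  have h1 : ((l + 1 : ℕ) : FPS d) * h ^ (l + 1 - 1) * b = ((l + 1 : ℕ) : ℝ) • (h ^ l * b) := by
    rw [smul_eq_C_mul, map_natCast, Nat.add_sub_cancel, mul_assoc]
  have hl : ((l + 1 : ℕ) : ℝ) ≠ 0 := Nat.cast_ne_zero.2 (by omega)
  have hl' : (Nat.factorial l : ℝ) ≠ 0 := Nat.cast_ne_zero.2 (Nat.factorial_ne_zero l)
  rw [h1, map_smul, smul_eq_mul, Nat.factorial_succ, Nat.cast_mul,
    show i + 2 * (l + 1) = i + 2 + 2 * l by ring]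
  field_simp
  ring

/-- Integration by parts in the Laplace expansion. -/
theorem gaussLaplace_pderiv {N i : ℕ} (hN : i + 1 < N) {h : FPS d} (hh : h ∈ ordIdeal d 3) (a : FPS d)
    (j : Fin d) : gaussLaplace N i h (pderiv ℝ j a) =
      gaussLaplace N (i + 2) h (a * (X j + pderiv ℝ j h)) := by
  obtain ⟨N, rfl⟩ := Nat.exists_eq_succ_of_ne_zero (Nat.ne_zero_of_lt hN)
  have h2 := pderiv_mem_ordIdeal hh j
  have h1 : gaussLaplace (N + 1) (i + 2) h (X j * a) = gaussLaplace (N + 1) i h (pderiv ℝ j a) -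
      gaussLaplace N (i + 2) h (a * pderiv ℝ j h) := by
    rw [sub_eq_add_neg, ← sum_gaussInt_natCast_mul_pow_pred, gaussLaplace, gaussLaplace,
      ← Finset.sum_add_distrib]
    refine Finset.sum_congr rfl fun l _ => ?_
    rw [← mul_add, ← map_add, show i + 2 + 2 * l = i + 2 * l + 2 by ring,
      show h ^ l * (X j * a) = X j * (h ^ l * a) by ring, gaussInt_X_mul, Derivation.leibniz,
      pderiv_pow, smul_eq_mul, smul_eq_mul]
    congr 2
    ring
  -- Differentiating `h ^ l` shifts the sum and shortens it to level `N`; the factor `pderiv ℝ j h`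
  -- of order 2 makes the levels `N` and `N + 1` agree.
  rw [mul_add, gaussLaplace_add, mul_comm a (X j), h1,
    gaussLaplace_of_le (N := N) (M := N + 1) hh (s := 2) (Ideal.mul_mem_left _ _ h2) (by omega)
      (by omega)]
  ring

/-! ### The right action of the phylon group by substitution -/

theorem jacobian_subst {ψ φ : Fin d → FPS d} (hφ : ∀ i, constantCoeff (φ i) = 0) :
    jacobian (fun i => subst φ (ψ i)) =
      (jacobian ψ).map (substAlgHom (hasSubst_of_zero hφ)) * jacobian φ := by
  refine Matrix.ext fun i j => ?_
  simp only [jacobian, Matrix.of_apply, pderiv_subst hφ, Matrix.mul_apply, Matrix.map_apply,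
    coe_substAlgHom]

theorem det_jacobian_subst {ψ φ : Fin d → FPS d} (hφ : ∀ i, constantCoeff (φ i) = 0) :
    (jacobian fun i => subst φ (ψ i)).det =
      subst φ (jacobian ψ).det * (jacobian φ).det := by
  rw [jacobian_subst hφ, Matrix.det_mul, ← coe_substAlgHom (hasSubst_of_zero hφ), AlgHom.map_det]
  rfl

theorem constantCoeff_det_jacobian (ψ : Fin d → FPS d) :
    constantCoeff (jacobian ψ).det = (linearPart ψ).det := by
  rw [RingHom.map_det]
  congr 1
  ext i j
  rw [RingHom.mapMatrix_apply, Matrix.map_apply, jacobian, linearPart, Matrix.of_apply,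
    Matrix.of_apply, ← coeff_zero_eq_constantCoeff_apply, coeff_pderiv]
  simp

namespace Phylon

theorem absSeries_mul {a b : FPS d} (ha : constantCoeff a ≠ 0) (hb : constantCoeff b ≠ 0) :
    absSeries (a * b) = absSeries a * absSeries b := by
  simp only [absSeries, map_mul]
  rcases lt_or_gt_of_ne ha with ha | ha <;> rcases lt_or_gt_of_ne hb with hb | hb
  · rw [if_pos (mul_pos_of_neg_of_neg ha hb), if_neg ha.not_gt, if_neg hb.not_gt, neg_mul_neg]
  · rw [if_neg (mul_neg_of_neg_of_pos ha hb).not_gt, if_neg ha.not_gt, if_pos hb, neg_mul]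
  · rw [if_neg (mul_neg_of_pos_of_neg ha hb).not_gt, if_pos ha, if_neg hb.not_gt, mul_neg]
  · rw [if_pos (mul_pos ha hb), if_pos ha, if_pos hb]

theorem absSeries_subst {φ : Fin d → FPS d} (hφ : ∀ i, constantCoeff (φ i) = 0) (a : FPS d) :
    absSeries (subst φ a) = subst φ (absSeries a) := by
  simp only [absSeries, constantCoeff_subst_zero hφ]
  split_ifs
  · rfl
  · rw [← coe_substAlgHom (hasSubst_of_zero hφ), map_neg]

theorem constantCoeff_absSeries (a : FPS d) :
    constantCoeff (absSeries a) = |constantCoeff a| := by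
  simp only [absSeries]
  split_ifs with h
  · rw [abs_of_pos h]
  · rw [map_neg, abs_of_nonpos (not_lt.1 h)]

theorem constantCoeff_det_jacobian_ne_zero (ψ : Phylon d) :
    constantCoeff (jacobian ψ.toFun).det ≠ 0 := by
  rw [constantCoeff_det_jacobian]
  exact ((Matrix.isUnit_iff_isUnit_det _).1 ψ.isUnit_linearPart).ne_zero

theorem hasSubst (ψ : Phylon d) : HasSubst ψ.toFun := hasSubst_of_zero ψ.constantCoeff_toFun

/-- The pullback `(b ∘ ψ) |det Dψ|` of a density. -/
def pullDensity (ψ : Phylon d) (b : FPS d) : FPS d :=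
  subst ψ.toFun b * absSeries (jacobian ψ.toFun).det

theorem mul_toFun (ψ φ : Phylon d) (i : Fin d) :
    (ψ * φ).toFun i = subst φ.toFun (ψ.toFun i) := rfl

theorem one_toFun : (1 : Phylon d).toFun = X := rfl

theorem subst_mul_toFun (ψ φ : Phylon d) (f : FPS d) :
    subst (ψ * φ).toFun f = subst φ.toFun (subst ψ.toFun f) :=
  (subst_comp_subst_apply ψ.hasSubst φ.hasSubst f).symm

theorem subst_one_toFun (f : FPS d) : subst (1 : Phylon d).toFun f = f := by
  rw [one_toFun, subst_self, id]

/-- Pullback is a right action, by the chain rule for Jacobians; the inverse in `actDensity` turns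
it into the left action. -/
theorem pullDensity_mul (ψ φ : Phylon d) (b : FPS d) :
    (ψ * φ).pullDensity b = φ.pullDensity (ψ.pullDensity b) := by
  rw [pullDensity, pullDensity, pullDensity, subst_mul_toFun, subst_mul φ.hasSubst]
  have h : (jacobian (ψ * φ).toFun).det =
      subst φ.toFun (jacobian ψ.toFun).det * (jacobian φ.toFun).det :=
    det_jacobian_subst φ.constantCoeff_toFun
  rw [h, absSeries_mul _ φ.constantCoeff_det_jacobian_ne_zero,
    absSeries_subst φ.constantCoeff_toFun, mul_assoc]
  rw [constantCoeff_subst_zero φ.constantCoeff_toFun]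
  exact ψ.constantCoeff_det_jacobian_ne_zero

theorem jacobian_X : jacobian (X : Fin d → FPS d) = 1 := by
  refine Matrix.ext fun i j => ?_
  rw [jacobian, Matrix.of_apply, pderiv_X, Matrix.one_apply, Pi.single_apply]

theorem pullDensity_one (b : FPS d) : (1 : Phylon d).pullDensity b = b := by
  rw [pullDensity, subst_one_toFun, one_toFun, jacobian_X, Matrix.det_one, absSeries,
    if_pos (by simp), mul_one]

theorem constantCoeff_pullDensity_ne_zero (ψ : Phylon d) {b : FPS d} (hb : constantCoeff b ≠ 0) :
    constantCoeff (ψ.pullDensity b) ≠ 0 := by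
  rw [pullDensity, map_mul, constantCoeff_subst_zero ψ.constantCoeff_toFun,
    constantCoeff_absSeries]
  exact mul_ne_zero hb (abs_ne_zero.2 ψ.constantCoeff_det_jacobian_ne_zero)

theorem actFun_eq (ψ : Phylon d) (f : FPS d) : ψ.actFun f = subst (ψ⁻¹).toFun f := rfl

theorem actDensity_eq (ψ : Phylon d) (b : FPS d) : ψ.actDensity b = (ψ⁻¹).pullDensity b := rfl

end Phylon

/-! ### Invariance of the Laplace coefficients under linear maps -/

/-- The parametrized ray `T ↦ T y`. -/
def ray (y : Fin d → ℝ) (i : Fin d) : MvPowerSeries Unit ℝ := C (y i) * X ()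

theorem hasSubst_ray (y : Fin d → ℝ) : HasSubst (ray y) :=
  hasSubst_of_constantCoeff_zero fun i => by simp [ray]

/-- Restricting to a line turns the homogeneous part into a coefficient in one variable, so its
behaviour under linear maps reduces to associativity of substitution. -/
theorem coeff_subst_ray (y : Fin d → ℝ) (p : FPS d) (k : ℕ) :
    coeff (Finsupp.single () k) (subst (ray y) p) = homogEval p k y := by
  have h : ∀ m : Fin d →₀ ℕ, coeff (Finsupp.single () k) (m.prod fun i n => ray y i ^ n) =
      if m.degree = k then ∏ i, y i ^ m i else 0 := by
    intro m
    rw [Finsupp.prod_fintype _ _ (by simp)]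
    simp only [ray, mul_pow, Finset.prod_mul_distrib, ← map_pow, ← map_prod, coeff_C_mul,
      Finset.prod_pow_eq_pow_sum, coeff_X_pow, ← Finsupp.degree_eq_sum]
    by_cases hk : m.degree = k
    · simp [hk]
    · rw [if_neg hk, if_neg, mul_zero]
      intro h
      exact hk (by simpa using (Finsupp.single_injective () h).symm)
  rw [coeff_subst (hasSubst_ray y), finsum_eq_sum_of_support_subset (s := Finset.univ.finsuppAntidiag k)]
  · refine Finset.sum_congr rfl fun m hm => ?_
    rw [h, if_pos (mem_univ_finsuppAntidiag.1 hm), smul_eq_mul]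
  · intro m hm
    rw [Finset.mem_coe, mem_univ_finsuppAntidiag]
    by_contra hk
    rw [Function.mem_support, h, if_neg hk, smul_zero] at hm
    exact hm rfl

theorem subst_ray_linSubst (A : Matrix (Fin d) (Fin d) ℝ) (y : Fin d → ℝ) (i : Fin d) :
    subst (ray y) (linSubst A i) = ray (A.mulVec y) i := by
  have hy := hasSubst_ray y
  rw [linSubst, ← coe_substAlgHom hy, map_sum]
  simp only [map_mul, coe_substAlgHom, subst_C, subst_X hy, ray, Matrix.mulVec, dotProduct, map_sum,
    Finset.sum_mul, mul_assoc]

theorem homogEval_subst_linSubst (A : Matrix (Fin d) (Fin d) ℝ) (p : FPS d) (k : ℕ)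
    (y : Fin d → ℝ) :
    homogEval (subst (linSubst A) p) k y = homogEval p k (A.mulVec y) := by
  rw [← coeff_subst_ray, ← coeff_subst_ray,
    subst_comp_subst_apply (hasSubst_of_zero (constantCoeff_linSubst A)) (hasSubst_ray y)]
  simp only [subst_ray_linSubst]

theorem homogEval_mul_C (p : FPS d) (c : ℝ) (k : ℕ) (y : Fin d → ℝ) :
    homogEval (p * C c) k y = c * homogEval p k y := by
  rw [homogEval, homogEval, Finset.mul_sum]
  refine Finset.sum_congr rfl fun m _ => ?_
  rw [coeff_mul_C]
  ring

theorem continuous_homogEval (p : FPS d) (k : ℕ) : Continuous (homogEval p k) := by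
  unfold homogEval
  fun_prop

theorem integral_comp_mulVec {A : Matrix (Fin d) (Fin d) ℝ} (hA : A.det ≠ 0) {F : (Fin d → ℝ) → ℝ}
    (hF : Continuous F) : ∫ y, |A.det| * F (A.mulVec y) = ∫ y, F y := by
  have h1 := Real.map_matrix_volume_pi_eq_smul_volume_pi hA
  have hc : Continuous (Matrix.toLin' A) := LinearMap.continuous_of_finiteDimensional _
  have h2 := MeasureTheory.integral_map (μ := MeasureTheory.volume) hc.aemeasurable
    hF.aestronglyMeasurable
  rw [h1, MeasureTheory.integral_smul_measure, ENNReal.toReal_ofReal (abs_nonneg _)] at h2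
  rw [MeasureTheory.integral_const_mul]
  simp only [Matrix.toLin'_apply] at h2
  rw [← h2, smul_eq_mul, ← mul_assoc, abs_inv, mul_inv_cancel₀ (abs_ne_zero.2 hA), one_mul]

theorem linearPart_linSubst (A : Matrix (Fin d) (Fin d) ℝ) : linearPart (linSubst A) = A := by
  ext i j
  simp [linSubst, linearPart, coeff_index_single_X]

namespace Phylon

/-- An invertible linear map as an element of the phylon group. -/
def ofMatrix (A : Matrix (Fin d) (Fin d) ℝ) (hA : IsUnit A) : Phylon d where
  toFun := linSubst A
  constantCoeff_toFun := constantCoeff_linSubst A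
  isUnit_linearPart := by rwa [linearPart_linSubst]

theorem absSeries_C (a : ℝ) : absSeries (C a : FPS d) = C |a| := by
  rw [absSeries, constantCoeff_C]
  split_ifs with h
  · rw [abs_of_pos h]
  · rw [abs_of_nonpos (not_lt.1 h), map_neg]

theorem pullDensity_ofMatrix {A : Matrix (Fin d) (Fin d) ℝ} (hA : IsUnit A) (b : FPS d) :
    (ofMatrix A hA).pullDensity b = subst (linSubst A) b * C |A.det| := by
  have : jacobian (linSubst A) = (C : ℝ →+* FPS d).mapMatrix A := by
    refine Matrix.ext fun i j => ?_
    rw [jacobian, Matrix.of_apply, pderiv_linSubst, RingHom.mapMatrix_apply, Matrix.map_apply]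
  rw [pullDensity, ofMatrix, this, ← RingHom.map_det, absSeries_C]

end Phylon

theorem phaseSpace_and_hessian_subst_linSubst {A : Matrix (Fin d) (Fin d) ℝ} (hA : IsUnit A)
    {f : FPS d} (hf : f ∈ phaseSpace d) : subst (linSubst A) f ∈ phaseSpace d ∧
      hessian (subst (linSubst A) f) = A.transpose * hessian f * A := by
  refine phaseSpace_and_hessian_eq_of_sub_quadForm ?_ ?_
  · rw [← Matrix.conjTranspose_eq_transpose_of_trivial]
    exact hf.2.2.conjTranspose_mul_mul_same (Matrix.mulVec_injective_of_isUnit hA)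
  · have hA0 := constantCoeff_linSubst A
    have := subst_mem_ordIdeal hA0 (sub_quadForm_mem_ordIdeal hf)
    rwa [subst_sub (hasSubst_of_zero hA0), subst_linSubst_quadForm] at this

/-- A linear map preserves degrees, so it commutes with taking homogeneous parts, and each term is
transformed by the ordinary substitution `y ↦ A y`. -/
theorem laplaceCoeff_linSubst {A : Matrix (Fin d) (Fin d) ℝ} (hA : IsUnit A)
    {f : FPS d} (hf : f ∈ phaseSpace d) (b : FPS d) (i : ℕ) :
    laplaceCoeff (subst (linSubst A) f) (subst (linSubst A) b * C |A.det|) i =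
      laplaceCoeff f b i := by
  have hA0 := hasSubst_of_zero (constantCoeff_linSubst A)
  have hH := (phaseSpace_and_hessian_subst_linSubst hA hf).2
  have hhp : higherPart (subst (linSubst A) f) = subst (linSubst A) (higherPart f) := by
    change _ - quadForm _ = subst _ (f - quadForm _)
    rw [subst_sub hA0, subst_linSubst_quadForm, hH]
  rw [laplaceCoeff, laplaceCoeff]
  refine Finset.sum_congr rfl fun l _ => ?_
  congr 1
  have hdet : A.det ≠ 0 := ((Matrix.isUnit_iff_isUnit_det _).1 hA).ne_zero
  have hc := continuous_homogEval (higherPart f ^ l * b) (i + 2 * l)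
  symm
  rw [← integral_comp_mulVec hdet]
  · refine MeasureTheory.integral_congr_ae (Filter.Eventually.of_forall fun y => ?_)
    beta_reduce
    rw [hhp, ← subst_pow hA0, ← mul_assoc (subst _ _), ← subst_mul hA0, homogEval_mul_C,
      homogEval_subst_linSubst, hH]
    have : y ⬝ᵥ (A.transpose * hessian f * A).mulVec y =
        A.mulVec y ⬝ᵥ (hessian f).mulVec (A.mulVec y) := by
      rw [← Matrix.mulVec_mulVec, ← Matrix.mulVec_mulVec, Matrix.dotProduct_mulVec,
        Matrix.vecMul_transpose]
    rw [this]
    ring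
  · refine Continuous.mul ?_ hc
    have : Continuous fun y : Fin d → ℝ => (hessian f).mulVec y :=
      Continuous.matrix_mulVec continuous_const continuous_id
    fun_prop

/-! ### Coefficientwise derivatives of families of power series -/

/-- The family `F` of formal power series has coefficientwise derivative `F'` at `t`. -/
def HasCoeffDerivAt (F : ℝ → FPS d) (F' : FPS d) (t : ℝ) : Prop :=
  ∀ e, HasDerivAt (fun s => coeff e (F s)) (coeff e F') t

namespace HasCoeffDerivAt

variable {F G : ℝ → FPS d} {F' G' : FPS d} {t : ℝ}

theorem const (f : FPS d) (t : ℝ) : HasCoeffDerivAt (fun _ => f) 0 t := fun e => by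
  simpa using hasDerivAt_const t (coeff e f)

theorem add (hF : HasCoeffDerivAt F F' t) (hG : HasCoeffDerivAt G G' t) :
    HasCoeffDerivAt (fun s => F s + G s) (F' + G') t := fun e => by
  simpa only [map_add] using (hF e).fun_add (hG e)

theorem sub_const (hF : HasCoeffDerivAt F F' t) (f : FPS d) :
    HasCoeffDerivAt (fun s => F s - f) F' t := fun e => by
  simpa using (hF e).sub_const (coeff e f)

theorem C_mul (t : ℝ) (f : FPS d) : HasCoeffDerivAt (fun s => C s * f) f t := fun e => by
  simpa using (hasDerivAt_id t).mul_const (coeff e f)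

theorem mul (hF : HasCoeffDerivAt F F' t) (hG : HasCoeffDerivAt G G' t) :
    HasCoeffDerivAt (fun s => F s * G s) (F' * G t + F t * G') t := fun e => by
  simp only [map_add, coeff_mul, ← Finset.sum_add_distrib]
  exact HasDerivAt.fun_sum fun p _ => (hF p.1).mul (hG p.2)

theorem pow (hF : HasCoeffDerivAt F F' t) (n : ℕ) :
    HasCoeffDerivAt (fun s => F s ^ n) ((n : FPS d) * F t ^ (n - 1) * F') t := by
  induction n with
  | zero => simpa using const 1 t
  | succ n ih =>
    have := ih.mul hF
    simp only [pow_succ]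
    convert this using 1
    rcases n with _ | n
    · simp
    · simp only [Nat.add_sub_cancel, pow_succ]
      push_cast
      ring

theorem linear_functional {ι : Type*} (s : Finset ι) (c : ι → ℝ) (m : ι → Fin d →₀ ℕ)
    (hF : HasCoeffDerivAt F F' t) :
    HasDerivAt (fun s' => ∑ i ∈ s, c i * coeff (m i) (F s')) (∑ i ∈ s, c i * coeff (m i) F') t :=
  HasDerivAt.fun_sum fun i _ => (hF (m i)).const_mul (c i)

theorem gaussInt (hF : HasCoeffDerivAt F F' t) (k : ℕ) :
    HasDerivAt (fun s => gaussInt k (F s)) (LaplaceExpansion.gaussInt k F') t := by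
  simp only [gaussInt_apply]
  exact linear_functional _ _ _ hF

/-- Differentiation of a composite with respect to the inner function. -/
theorem subst {Φ : ℝ → Fin d → FPS d} {Φ' : Fin d → FPS d}
    (h0 : ∀ s i, constantCoeff (Φ s i) = 0)
    (h : ∀ i, HasCoeffDerivAt (fun s => Φ s i) (Φ' i) t) (f : FPS d) :
    HasCoeffDerivAt (fun s => MvPowerSeries.subst (Φ s) f)
      (∑ i, MvPowerSeries.subst (Φ t) (pderiv ℝ i f) * Φ' i) t := by
  have hs := fun s => hasSubst_of_zero (h0 s)
  have hp : ∀ p : MvPolynomial (Fin d) ℝ, HasCoeffDerivAt (fun s => MvPowerSeries.subst (Φ s) (p : FPS d))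
      (∑ i, MvPowerSeries.subst (Φ t) (pderiv ℝ i (p : FPS d)) * Φ' i) t := by
    intro p
    induction p using MvPolynomial.induction_on with
    | C a =>
      simp only [MvPolynomial.coe_C, subst_C, pderiv_C]
      convert const (C a) t using 1
      refine Finset.sum_eq_zero fun i _ => ?_
      rw [← coe_substAlgHom (hs t), map_zero, zero_mul]
    | add p q hp hq =>
      simp only [MvPolynomial.coe_add, subst_add (hs _), map_add, add_mul, Finset.sum_add_distrib]
      exact hp.add hq
    | mul_X p j hp =>
      simp only [MvPolynomial.coe_mul, MvPolynomial.coe_X, subst_mul (hs _), subst_X (hs _)]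
      convert hp.mul (h j) using 1
      simp only [Derivation.leibniz, smul_eq_mul, subst_add (hs t), subst_mul (hs t),
        subst_X (hs t), add_mul, Finset.sum_add_distrib]
      rw [add_comm]
      congr 1
      · rw [Finset.sum_mul]
        exact Finset.sum_congr rfl fun i _ => by ring
      · rw [Finset.sum_eq_single j]
        · rw [pderiv_X_self, ← coe_substAlgHom (hs t), map_one, mul_one]
        · intro l _ hl
          rw [pderiv_X_of_ne hl.symm, ← coe_substAlgHom (hs t), map_zero, mul_zero, zero_mul]
        · simp
  intro e
  -- The formula for the derivative contains `pderiv ℝ i f`, which costs one degree; hence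
  -- truncation at `e.degree + 2`.
  have hr := sub_truncTotal_mem_ordIdeal f (e.degree + 2)
  refine (hp (truncTotal (e.degree + 2) f) e).congr_deriv ?_ |>.congr_of_eventuallyEq ?_
  · rw [← sub_eq_zero, ← map_sub, ← Finset.sum_sub_distrib]
    have : ∑ i, (MvPowerSeries.subst (Φ t)
        (pderiv ℝ i (truncTotal (e.degree + 2) f : FPS d)) * Φ' i -
        MvPowerSeries.subst (Φ t) (pderiv ℝ i f) * Φ' i) ∈ ordIdeal d (e.degree + 1) := by
      refine sum_mem fun i _ => ?_
      rw [← sub_mul, ← subst_sub (hs t), ← map_sub]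
      refine Ideal.mul_mem_right _ _ (subst_mem_ordIdeal (h0 t) (pderiv_mem_ordIdeal ?_ i))
      rw [← neg_sub]
      exact neg_mem hr
    exact this e (Nat.lt_succ_self _)
  · refine Filter.Eventually.of_forall fun s => ?_
    have := subst_mem_ordIdeal (h0 s) hr e (by omega)
    rwa [subst_sub (hs s), map_sub, sub_eq_zero] at this

/-- The derivative of a family of Laplace coefficients. -/
theorem gaussLaplace (hF : HasCoeffDerivAt F F' t) (hG : HasCoeffDerivAt G G' t) (N i : ℕ) :
    HasDerivAt (fun s => gaussLaplace (N + 1) i (F s) (G s))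
      (LaplaceExpansion.gaussLaplace (N + 1) i (F t) G' -
        LaplaceExpansion.gaussLaplace N (i + 2) (F t) (F' * G t)) t := by
  rw [sub_eq_add_neg, ← sum_gaussInt_natCast_mul_pow_pred, LaplaceExpansion.gaussLaplace,
    ← Finset.sum_add_distrib]
  refine HasDerivAt.fun_sum fun l _ => ?_
  refine ((((hF.pow l).mul hG).gaussInt (i + 2 * l)).const_mul _).congr_deriv ?_
  rw [← mul_add, ← map_add]
  congr 2
  ring

end HasCoeffDerivAt

/-! ### Invariance under changes of a single coordinate -/

/-- The change of variables that adds `u` to the coordinate `xʲ`. -/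
def shear (j : Fin d) (u : FPS d) (i : Fin d) : FPS d := X i + if i = j then u else 0

theorem constantCoeff_shear (j : Fin d) {u : FPS d} (hu : u ∈ ordIdeal d 2) (i : Fin d) :
    constantCoeff (shear j u i) = 0 := by
  have := mem_ordIdeal_one.1 (ordIdeal_anti one_le_two hu)
  rw [shear, map_add, constantCoeff_X, zero_add]
  split_ifs <;> simp [this]

theorem det_jacobian_shear (j : Fin d) (u : FPS d) :
    (jacobian (shear j u)).det = 1 + pderiv ℝ j u := by
  have : jacobian (shear j u) = (1 : Matrix (Fin d) (Fin d) (FPS d)).updateRow j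
      (fun k => (1 : Matrix (Fin d) (Fin d) (FPS d)) j k + pderiv ℝ k u) := by
    refine Matrix.ext fun i k => ?_
    rw [jacobian, Matrix.of_apply, shear, map_add, Matrix.updateRow_apply, pderiv_X,
      Matrix.one_apply, Pi.single_apply]
    split_ifs with h1 h2 <;> simp_all [Matrix.one_apply]
  rw [this, ← Matrix.cramer_transpose_apply, Matrix.transpose_one, Matrix.cramer_one]
  simp

/-- A change of variables tangent to the identity alters a series of order 2 only from degree 3 on.
-/
theorem phaseSpace_and_hessian_subst_of_tangent {θ : Fin d → FPS d}
    (h : ∀ i, θ i - X i ∈ ordIdeal d 2) {f : FPS d} (hf : f ∈ phaseSpace d) :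
    subst θ f ∈ phaseSpace d ∧ hessian (subst θ f) = hessian f := by
  have h0 : ∀ i, constantCoeff (θ i) = 0 := fun i => by
    have := add_mem (ordIdeal_anti one_le_two (h i)) (X_mem_ordIdeal i)
    rw [sub_add_cancel] at this
    exact mem_ordIdeal_one.1 this
  refine phaseSpace_and_hessian_eq_of_sub_quadForm hf.2.2 ?_
  have h1 := succ_order_le_sub_subst h0 (fun i => mem_ordIdeal_iff_le_order.1 (h i)) f 2
    (mem_ordIdeal_iff_le_order.1 (mem_ordIdeal_two_of_mem_phaseSpace hf))
  have := sub_mem (sub_quadForm_mem_ordIdeal hf) (mem_ordIdeal_iff_le_order.2 h1)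
  rwa [sub_sub_sub_cancel_left] at this

/-- The shear is deformed to the identity by replacing `u` with `t u`. The Laplace coefficient has
zero derivative in `t`, since the integrand varies by a total derivative in `xʲ`. -/
theorem laplaceCoeff_shear (j : Fin d) {u : FPS d} (hu : u ∈ ordIdeal d 2) {f : FPS d}
    (hf : f ∈ phaseSpace d) (hH : hessian f = 1) (b : FPS d) (i : ℕ) :
    laplaceCoeff (subst (shear j u) f) (subst (shear j u) b * (1 + pderiv ℝ j u)) i =
      laplaceCoeff f b i := by
  let Φ : ℝ → Fin d → FPS d := fun t => shear j (C t * u)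
  let F : ℝ → FPS d := fun t => subst (Φ t) f
  let B : ℝ → FPS d := fun t => subst (Φ t) b * (1 + C t * pderiv ℝ j u)
  have hΦ2 : ∀ t, C t * u ∈ ordIdeal d 2 := fun t => Ideal.mul_mem_left _ _ hu
  have hΦ0 : ∀ t i, constantCoeff (Φ t i) = 0 := fun t => constantCoeff_shear j (hΦ2 t)
  have hΦt : ∀ t i, Φ t i - X i ∈ ordIdeal d 2 := by
    intro t i
    simp only [Φ, shear, add_sub_cancel_left]
    split_ifs
    exacts [hΦ2 t, zero_mem _]
  have hFp := fun t => phaseSpace_and_hessian_subst_of_tangent (hΦt t) hf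
  have hF3 : ∀ t, F t - quadForm 1 ∈ ordIdeal d 3 := fun t => by
    have := sub_quadForm_mem_ordIdeal (hFp t).1
    rwa [(hFp t).2, hH] at this
  have hΦd : ∀ t i, HasCoeffDerivAt (fun s => Φ s i) (if i = j then u else 0) t := by
    intro t i
    have h1 := HasCoeffDerivAt.C_mul t u
    simp only [Φ, shear]
    split_ifs
    · simpa using (HasCoeffDerivAt.const (X i) t).add h1
    · simpa using HasCoeffDerivAt.const (X i) t
  have hsub : ∀ t (p : FPS d), HasCoeffDerivAt (fun s => subst (Φ s) p)
      (subst (Φ t) (pderiv ℝ j p) * u) t := by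
    intro t p
    simpa using HasCoeffDerivAt.subst hΦ0 (hΦd t) p
  have hpd : ∀ t (p : FPS d), pderiv ℝ j (subst (Φ t) p) =
      subst (Φ t) (pderiv ℝ j p) * (1 + C t * pderiv ℝ j u) := by
    intro t p
    rw [pderiv_subst (hΦ0 t), Finset.sum_eq_single j]
    · simp [Φ, shear, Derivation.leibniz]
    · intro k _ hk
      simp [Φ, shear, hk, pderiv_X_of_ne hk]
    · simp
  have hB : ∀ t, HasCoeffDerivAt B (pderiv ℝ j (u * subst (Φ t) b)) t := by
    intro t
    have h1 := (hsub t b).mul ((HasCoeffDerivAt.const 1 t).add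
      (HasCoeffDerivAt.C_mul t (pderiv ℝ j u)))
    convert h1 using 1
    rw [Derivation.leibniz, hpd, smul_eq_mul, smul_eq_mul]
    ring
  have hq : pderiv ℝ j (quadForm (1 : Matrix (Fin d) (Fin d) ℝ)) = X j := by
    rw [pderiv_quadForm Matrix.isSymm_one, linSubst]
    simp [Matrix.one_apply]
  -- A truncation level larger than needed is used because differentiation in the phase lowers it by
  -- one.
  have hconst : ∀ t, HasDerivAt
      (fun s => gaussLaplace (i + 2 + 1) i (F s - quadForm 1) (B s)) 0 t := by
    intro t
    refine (((hsub t f).sub_const (quadForm 1)).gaussLaplace (hB t) (i + 2) i).congr_deriv ?_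
    rw [gaussLaplace_pderiv (by omega) (hF3 t), sub_eq_zero]
    have h1 : X j + pderiv ℝ j (F t - quadForm 1) = pderiv ℝ j (F t) := by
      rw [map_sub, hq, add_sub_cancel]
    have h2 : subst (Φ t) (pderiv ℝ j f) * u * B t =
        u * subst (Φ t) b * (X j + pderiv ℝ j (F t - quadForm 1)) := by
      rw [h1, hpd]
      simp only [B]
      ring
    -- The factor `X j + pderiv ℝ j (F t - quadForm 1)` has order 1, so the levels `i + 2` and `i +
    -- 3` give the same value at index `i + 2`.
    rw [h2, gaussLaplace_of_le (hF3 t) (s := 1) (N := i + 2) (M := i + 2 + 1) _ (by omega) (by omega)]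
    refine Ideal.mul_mem_left _ _ (add_mem (X_mem_ordIdeal j) ?_)
    exact ordIdeal_anti one_le_two (pderiv_mem_ordIdeal (hF3 t) j)
  have key := is_const_of_deriv_eq_zero (fun t => (hconst t).differentiableAt)
    (fun t => (hconst t).deriv) 1 0
  have hlap : ∀ t, laplaceCoeff (F t) (B t) i =
      gaussLaplace (i + 2 + 1) i (F t - quadForm 1) (B t) := fun t => by
    rw [laplaceCoeff_eq_gaussLaplace ((hFp t).2.trans hH),
      gaussLaplace_of_le (M := i + 2 + 1) (hF3 t) (mem_ordIdeal_zero _) (by omega) (by omega)]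
  have h1 : Φ 1 = shear j u := by simp [Φ]
  have h0 : Φ 0 = X := by
    funext i
    simp [Φ, shear]
  rw [← hlap, ← hlap] at key
  simpa only [F, B, h1, h0, subst_self, id, map_one, map_zero, one_mul, zero_mul, add_zero,
    mul_one] using key

/-! ### Invariance of the Laplace coefficients under the phylon group -/

-- With `H = Uᵀ U` and `U` invertible, `A = U⁻¹` works. This reduces all later arguments to the
-- standard Gaussian.
open scoped MatrixOrder Matrix.Norms.L2Operator in
theorem exists_transpose_mul_mul_eq_one {H : Matrix (Fin d) (Fin d) ℝ} (hH : H.PosDef) :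
    ∃ A : Matrix (Fin d) (Fin d) ℝ, IsUnit A ∧ A.transpose * H * A = 1 := by
  obtain ⟨B, ⟨U, rfl⟩, rfl⟩ := CStarAlgebra.isStrictlyPositive_iff_eq_star_mul_self.1
    hH.isStrictlyPositive
  refine ⟨(U⁻¹ : (Matrix (Fin d) (Fin d) ℝ)ˣ), Units.isUnit _, ?_⟩
  rw [← Matrix.conjTranspose_eq_transpose_of_trivial, ← Matrix.star_eq_conjTranspose,
    mul_assoc, mul_assoc, Units.mul_inv, mul_one, ← star_mul, Units.mul_inv, star_one]

theorem linearPart_eq_one_iff {θ : Fin d → FPS d} (h0 : ∀ i, constantCoeff (θ i) = 0) :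
    linearPart θ = 1 ↔ ∀ i, θ i - X i ∈ ordIdeal d 2 := by
  rw [← linearPart_X]
  constructor
  · intro h i e he
    rcases Nat.lt_succ_iff_lt_or_eq.1 he with h1 | h1
    · have : e = 0 := (Finsupp.degree_eq_zero_iff e).1 (by omega)
      subst this
      simp [h0]
    · obtain ⟨j, rfl⟩ := eq_single_of_degree_eq_one h1
      have := congrFun (congrFun h i) j
      simpa [linearPart, sub_eq_zero] using this
  · intro h
    ext i j
    have := h i (Finsupp.single j 1) (by rw [Finsupp.degree_single]; norm_num)
    rwa [map_sub, sub_eq_zero] at this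

namespace Phylon

theorem linearPart_mul (ψ φ : Phylon d) :
    linearPart (ψ * φ).toFun = linearPart ψ.toFun * linearPart φ.toFun :=
  linearPart_comp φ.constantCoeff_toFun

theorem linearPart_inv_mul (ψ : Phylon d) :
    linearPart (ψ⁻¹).toFun * linearPart ψ.toFun = 1 := by
  rw [← linearPart_mul, inv_mul_cancel, one_toFun, linearPart_X]

/-- The shear `xʲ ↦ xʲ + u` as an element of the phylon group. -/
def ofShear (j : Fin d) (u : FPS d) (hu : u ∈ ordIdeal d 2) : Phylon d where
  toFun := shear j u
  constantCoeff_toFun := constantCoeff_shear j hu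
  isUnit_linearPart := by
    rw [(linearPart_eq_one_iff (constantCoeff_shear j hu)).2]
    · exact isUnit_one
    · intro i
      rw [shear, add_sub_cancel_left]
      split_ifs
      exacts [hu, zero_mem _]

theorem pullDensity_ofShear (j : Fin d) {u : FPS d} (hu : u ∈ ordIdeal d 2) (b : FPS d) :
    (ofShear j u hu).pullDensity b = subst (shear j u) b * (1 + pderiv ℝ j u) := by
  rw [pullDensity]
  congr 1
  have h : (jacobian (ofShear j u hu).toFun).det = 1 + pderiv ℝ j u := det_jacobian_shear j u
  rw [h, absSeries, if_pos]
  rw [map_add, mem_ordIdeal_one.1 (pderiv_mem_ordIdeal hu j)]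
  simp

/-- A change tangent to the identity is a product of shears. If `E` is the shear with the same
`j`-th component as `ψ`, then `ψ * E⁻¹` fixes `xʲ` and every coordinate already fixed by `ψ`, so
fewer coordinates move. -/
theorem laplaceCoeff_of_tangent_of_moves (s : Finset (Fin d)) :
    ∀ ψ : Phylon d, (∀ i, ψ.toFun i - X i ∈ ordIdeal d 2) → (∀ i ∉ s, ψ.toFun i = X i) →
      ∀ f ∈ phaseSpace d, hessian f = 1 → ∀ b i,
        laplaceCoeff (subst ψ.toFun f) (ψ.pullDensity b) i = laplaceCoeff f b i := by
  induction s using Finset.induction_on with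
  | empty =>
    intro ψ _ hψ f _ _ b i
    have : ψ = 1 := Phylon.ext (funext fun i => hψ i (Finset.notMem_empty i))
    rw [this, subst_one_toFun, pullDensity_one]
  | insert j t hj ih =>
    intro ψ hψ2 hψ f hf hH b i
    set E := ofShear j (ψ.toFun j - X j) (hψ2 j) with hE
    have hEj : E.toFun j = ψ.toFun j := by
      change shear j _ j = _
      simp [shear]
    have hEi : ∀ i, i ≠ j → E.toFun i = X i := by
      intro i hi
      change shear j _ i = _
      simp [shear, hi]
    have hE2 : ∀ i, E.toFun i - X i ∈ ordIdeal d 2 := by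
      intro i
      by_cases h : i = j
      · rw [h, hEj]
        exact hψ2 j
      · rw [hEi i h, sub_self]
        exact zero_mem _
    have hEE : ∀ i, subst (E⁻¹).toFun (E.toFun i) = X i := by
      intro i
      rw [← mul_toFun, mul_inv_cancel, one_toFun]
    have hψE : ψ = (ψ * E⁻¹) * E := by rw [inv_mul_cancel_right]
    have hlin : linearPart (ψ * E⁻¹).toFun = 1 := by
      have h1 := linearPart_inv_mul E
      rw [(linearPart_eq_one_iff E.constantCoeff_toFun).2 hE2, mul_one] at h1
      rw [linearPart_mul, h1, mul_one, (linearPart_eq_one_iff ψ.constantCoeff_toFun).2 hψ2]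
    have htan := (linearPart_eq_one_iff (ψ * E⁻¹).constantCoeff_toFun).1 hlin
    have hmov : ∀ i ∉ t, (ψ * E⁻¹).toFun i = X i := by
      intro i hi
      rw [mul_toFun]
      by_cases h : i = j
      · rw [h, ← hEj, hEE]
      · rw [hψ i (by simp [h, hi]), ← hEi i h, hEE, hEi i h]
    have hp := phaseSpace_and_hessian_subst_of_tangent htan hf
    rw [hψE, pullDensity_mul, subst_mul_toFun, hE, pullDensity_ofShear]
    exact (laplaceCoeff_shear j (hψ2 j) hp.1 (hp.2.trans hH) _ i).trans
      (ih _ htan hmov f hf hH b i)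

theorem linearPart_mul_inv_ofMatrix (ψ : Phylon d) :
    linearPart (ψ * (ofMatrix _ ψ.isUnit_linearPart)⁻¹).toFun = 1 := by
  have h1 := linearPart_inv_mul (ofMatrix _ ψ.isUnit_linearPart)
  have h2 : linearPart (ofMatrix _ ψ.isUnit_linearPart).toFun = linearPart ψ.toFun :=
    linearPart_linSubst _
  rw [h2] at h1
  rw [linearPart_mul]
  exact mul_eq_one_comm.1 h1

theorem subst_mem_phaseSpace (ψ : Phylon d) {f : FPS d} (hf : f ∈ phaseSpace d) :
    subst ψ.toFun f ∈ phaseSpace d := by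
  have h := inv_mul_cancel_right ψ (ofMatrix _ ψ.isUnit_linearPart)
  rw [← h, subst_mul_toFun]
  exact (phaseSpace_and_hessian_subst_linSubst ψ.isUnit_linearPart
    (phaseSpace_and_hessian_subst_of_tangent
      ((linearPart_eq_one_iff (Phylon.constantCoeff_toFun _)).1 ψ.linearPart_mul_inv_ofMatrix)
      hf).1).1

/-- The Laplace coefficients are invariant under the phylon group. -/
theorem laplaceCoeff_pull (ψ : Phylon d) {f : FPS d} (hf : f ∈ phaseSpace d) (b : FPS d) (i : ℕ) :
    laplaceCoeff (subst ψ.toFun f) (ψ.pullDensity b) i = laplaceCoeff f b i := by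
  obtain ⟨A, hA, hAH⟩ := exists_transpose_mul_mul_eq_one hf.2.2
  have hfA := phaseSpace_and_hessian_subst_linSubst hA hf
  -- The factorisation is `ψ = a * θ * L`: `a` normalises the Hessian to `1`, `θ` is tangent to the
  -- identity, and the linear map `L` is the linear part of `a⁻¹ * ψ`.
  set a := ofMatrix A hA with ha
  set χ := a⁻¹ * ψ with hχ
  set θ := χ * (ofMatrix _ χ.isUnit_linearPart)⁻¹ with hθ
  have hθ2 := (linearPart_eq_one_iff (Phylon.constantCoeff_toFun _)).1
    χ.linearPart_mul_inv_ofMatrix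
  have hψ : ψ = a * (θ * ofMatrix _ χ.isUnit_linearPart) := by
    rw [hθ, inv_mul_cancel_right, hχ, mul_inv_cancel_left]
  have h1 := laplaceCoeff_linSubst hA hf b i
  rw [← pullDensity_ofMatrix hA] at h1
  have h2 := laplaceCoeff_of_tangent_of_moves Finset.univ θ hθ2 (by simp) _ hfA.1
    (hfA.2.trans hAH) (a.pullDensity b) i
  have h3 := laplaceCoeff_linSubst χ.isUnit_linearPart (θ.subst_mem_phaseSpace hfA.1)
    (θ.pullDensity (a.pullDensity b)) i
  rw [← pullDensity_ofMatrix χ.isUnit_linearPart] at h3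
  rw [hψ, pullDensity_mul, subst_mul_toFun, pullDensity_mul, subst_mul_toFun]
  exact h3.trans (h2.trans h1)

end Phylon

/-! ### Radial series and divergences of tangential fields -/

/-- The series `|x|²`. -/
def sqNorm (d : ℕ) : FPS d := ∑ i, X i * X i

/-- The Euler operator `xⁱ ∂ᵢ`. -/
def euler (r : FPS d) : FPS d := ∑ i, X i * pderiv ℝ i r

/-- The divergence of a formal vector field. -/
def divergence (v : Fin d → FPS d) : FPS d := ∑ i, pderiv ℝ i (v i)

/-- The polynomials in `|x|²`. -/
def radialSpan (d : ℕ) : Submodule ℝ (FPS d) :=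
  Submodule.span ℝ (Set.range fun j : ℕ => sqNorm d ^ j)

theorem quadForm_one : quadForm (1 : Matrix (Fin d) (Fin d) ℝ) = C (1 / 2 : ℝ) * sqNorm d := by
  rw [quadForm_eq_sum_linSubst, sqNorm]
  congr 1
  refine Finset.sum_congr rfl fun i _ => ?_
  simp [linSubst, Matrix.one_apply]

theorem sqNorm_mem_ordIdeal : sqNorm d ∈ ordIdeal d 2 :=
  sum_mem fun i _ => mul_mem_ordIdeal (X_mem_ordIdeal i) (X_mem_ordIdeal i)

theorem pderiv_sqNorm (i : Fin d) : pderiv ℝ i (sqNorm d) = 2 * X i := by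
  simp [sqNorm, Derivation.leibniz, pderiv_X, Pi.single_apply, two_mul, Finset.sum_add_distrib]

theorem coeff_X_mul_pderiv (i : Fin d) (r : FPS d) (e : Fin d →₀ ℕ) :
    coeff e (X i * pderiv ℝ i r) = e i * coeff e r := by
  classical
  rw [X, coeff_monomial_mul]
  split_ifs with h
  · obtain ⟨m, rfl⟩ := exists_add_of_le h
    rw [add_tsub_cancel_left, coeff_pderiv, one_mul, add_comm m]
    simp
    ring
  · have : e i = 0 := by
      by_contra h0
      exact h (Finsupp.single_le_iff.2 (Nat.one_le_iff_ne_zero.2 h0))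
    rw [this, Nat.cast_zero, zero_mul]

theorem coeff_euler (r : FPS d) (e : Fin d →₀ ℕ) :
    coeff e (euler r) = e.degree * coeff e r := by
  simp only [euler, map_sum, coeff_X_mul_pderiv, ← Finset.sum_mul, Finsupp.degree_eq_sum,
    Nat.cast_sum]

theorem euler_sqNorm_pow (j : ℕ) : euler (sqNorm d ^ j) = ((2 * j : ℕ) : FPS d) * sqNorm d ^ j := by
  have h : euler (sqNorm d ^ j) = ((2 * j : ℕ) : FPS d) * sqNorm d ^ (j - 1) * sqNorm d := by
    rw [euler]
    conv_rhs => rw [sqNorm, Finset.mul_sum]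
    refine Finset.sum_congr rfl fun i _ => ?_
    rw [pderiv_pow, pderiv_sqNorm, sqNorm]
    push_cast
    ring
  rw [h]
  rcases j with _ | j
  · simp
  · rw [Nat.add_sub_cancel, pow_succ]
    ring

/-- Homogeneity comes from Euler's identity: the coefficient times `e.degree` equals the coefficient
times `2 * j`. -/
theorem coeff_sqNorm_pow_eq_zero {j : ℕ} {e : Fin d →₀ ℕ} (he : e.degree ≠ 2 * j) :
    coeff e (sqNorm d ^ j) = 0 := by
  have h := coeff_euler (sqNorm d ^ j) e
  rw [euler_sqNorm_pow, ← map_natCast (C : ℝ →+* FPS d), coeff_C_mul, ← sub_eq_zero, ← sub_mul,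
    mul_eq_zero, sub_eq_zero] at h
  refine h.resolve_left fun h' => he ?_
  exact_mod_cast h'.symm

/-- A radial series has one free scalar in each even degree. For odd `n` the division rounds down
and the right-hand coefficients vanish, as they must. -/
theorem coeff_of_mem_radialSpan {ρ : FPS d} (hρ : ρ ∈ radialSpan d) (n : ℕ) :
    ∃ c : ℝ, ∀ e : Fin d →₀ ℕ, e.degree = n → coeff e ρ = c * coeff e (sqNorm d ^ (n / 2)) := by
  induction hρ using Submodule.span_induction with
  | mem p hp =>
    obtain ⟨j, rfl⟩ := hp
    by_cases h : n = 2 * j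
    · refine ⟨1, fun e _ => ?_⟩
      rw [h, Nat.mul_div_cancel_left _ two_pos, one_mul]
    · refine ⟨0, fun e he => ?_⟩
      rw [zero_mul]
      exact coeff_sqNorm_pow_eq_zero (he ▸ h)
  | zero => exact ⟨0, by simp⟩
  | add p q _ _ hp hq =>
    obtain ⟨a, ha⟩ := hp
    obtain ⟨b, hb⟩ := hq
    exact ⟨a + b, fun e he => by rw [map_add, ha e he, hb e he, add_mul]⟩
  | smul a p _ hp =>
    obtain ⟨b, hb⟩ := hp
    exact ⟨a * b, fun e he => by rw [coeff_smul, hb e he, mul_assoc]⟩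

theorem sqNorm_mul_mem_radialSpan {ρ : FPS d} (hρ : ρ ∈ radialSpan d) :
    sqNorm d * ρ ∈ radialSpan d := by
  induction hρ using Submodule.span_induction with
  | mem p hp =>
    obtain ⟨j, rfl⟩ := hp
    exact Submodule.subset_span ⟨j + 1, pow_succ' _ _⟩
  | zero => simp
  | add p q _ _ hp hq => rw [mul_add]; exact add_mem hp hq
  | smul a p _ hp => rw [mul_smul_comm]; exact Submodule.smul_mem _ _ hp

theorem C_mem_radialSpan (a : ℝ) : (C a : FPS d) ∈ radialSpan d := by
  have : (C a : FPS d) = a • sqNorm d ^ 0 := by rw [pow_zero, smul_eq_C_mul, mul_one]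
  rw [this]
  exact Submodule.smul_mem _ _ (Submodule.subset_span ⟨0, rfl⟩)

theorem sub_C_mem_ordIdeal (b : FPS d) : b - C (constantCoeff b) ∈ ordIdeal d 1 :=
  mem_ordIdeal_one.2 (by simp)

theorem divergence_mem_ordIdeal {k : ℕ} {v : Fin d → FPS d} (hv : ∀ i, v i ∈ ordIdeal d (k + 1)) :
    divergence v ∈ ordIdeal d k := sum_mem fun i _ => pderiv_mem_ordIdeal (hv i) i

theorem pderiv_C_mul (i : Fin d) (a : ℝ) (p : FPS d) :
    pderiv ℝ i (C a * p) = C a * pderiv ℝ i p := by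
  rw [Derivation.leibniz, pderiv_C, smul_zero, add_zero, smul_eq_mul]

theorem divergence_C_mul_sub (a : ℝ) (v w : Fin d → FPS d) :
    divergence (fun i => C a * (v i - w i)) = C a * (divergence v - divergence w) := by
  simp only [divergence, pderiv_C_mul, map_sub, ← Finset.mul_sum, Finset.sum_sub_distrib]

/-- The decomposition of `|x|² Δ` into an operator in the Euler field and a divergence of a
tangential field. -/
theorem sqNorm_mul_laplacian_sub_divergence (r : FPS d) :
    sqNorm d * divergence (fun i => pderiv ℝ i r) -
      divergence (fun i => sqNorm d * pderiv ℝ i r - X i * euler r) =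
    euler (euler r) + ((d : FPS d) - 2) * euler r := by
  have h1 : ∀ i, pderiv ℝ i (sqNorm d * pderiv ℝ i r - X i * euler r) =
      sqNorm d * pderiv ℝ i (pderiv ℝ i r) + 2 * (X i * pderiv ℝ i r) -
        (X i * pderiv ℝ i (euler r) + euler r) := by
    intro i
    rw [map_sub, Derivation.leibniz, Derivation.leibniz, pderiv_sqNorm, pderiv_X_self]
    simp only [smul_eq_mul]
    ring
  simp only [divergence, h1, Finset.sum_sub_distrib, Finset.sum_add_distrib, ← Finset.mul_sum,
    Finset.sum_const, Finset.card_univ, Fintype.card_fin, nsmul_eq_mul]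
  change _ - (_ + 2 * euler r - (euler (euler r) + _)) = _
  ring

/-- Modulo higher order, each series is the sum of a radial one and the divergence of a field that
is tangent to the spheres. -/
theorem exists_tangential_divergence (hd : 1 < d) (k : ℕ) :
    ∀ r ∈ ordIdeal d k, ∃ v : Fin d → FPS d, (∀ i, v i ∈ ordIdeal d (k + 1)) ∧
      ∑ i, X i * v i = 0 ∧ ∃ ρ ∈ radialSpan d, r - divergence v - ρ ∈ ordIdeal d (k + 1) := by
  induction k using Nat.strong_induction_on with
  | _ k ih =>
  intro r hr
  rcases Nat.eq_zero_or_pos k with rfl | hk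
  · refine ⟨0, fun i => zero_mem _, by simp, _, C_mem_radialSpan (constantCoeff r), ?_⟩
    simpa [divergence] using sub_C_mem_ordIdeal r
  -- The induction is applied to the Laplacian of `r`, two degrees lower. For `k = 1` no such degree
  -- exists, but the factor `sqNorm d` alone already has order `k + 1`.
  have hmain : ∃ w : Fin d → FPS d, (∀ i, sqNorm d * w i ∈ ordIdeal d (k + 1)) ∧
      ∑ i, X i * w i = 0 ∧ ∃ ρ ∈ radialSpan d,
      sqNorm d * (divergence (fun i => pderiv ℝ i r) - divergence w - ρ) ∈ ordIdeal d (k + 1) := by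
    obtain ⟨k, rfl⟩ := Nat.exists_eq_succ_of_ne_zero hk.ne'
    rcases k with _ | k
    · refine ⟨0, fun i => by simp, by simp, 0, zero_mem _, ?_⟩
      exact Ideal.mul_mem_right _ _ sqNorm_mem_ordIdeal
    · obtain ⟨w, hw, hw0, ρ, hρ, h⟩ := ih k (by omega) (divergence fun i => pderiv ℝ i r)
        (divergence_mem_ordIdeal fun i => pderiv_mem_ordIdeal hr i)
      refine ⟨w, fun i => ?_, hw0, ρ, hρ, ?_⟩
      · exact ordIdeal_anti (by omega) (mul_mem_ordIdeal sqNorm_mem_ordIdeal (hw i))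
      · exact ordIdeal_anti (by omega) (mul_mem_ordIdeal sqNorm_mem_ordIdeal h)
  obtain ⟨w, hw, hw0, ρ, hρ, h⟩ := hmain
  -- The Euler operator is multiplication by `k` in degree `k`, so `κ` is the value of `E² + (d - 2)
  -- E` there. Its nonvanishing uses `d > 1`: for `d = 1` it fails at `k = 1`.
  set κ : ℝ := k * (k + d - 2) with hκ
  have hκ0 : κ ≠ 0 := by
    have h1 : (1 : ℝ) ≤ k := by exact_mod_cast hk
    have h2 : (2 : ℝ) ≤ d := by exact_mod_cast hd
    exact (mul_pos (by linarith) (by linarith)).ne'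
  set v₀ : Fin d → FPS d := fun i => sqNorm d * pderiv ℝ i r - X i * euler r with hv₀
  have heul : ∀ {p : FPS d}, p ∈ ordIdeal d k → euler p ∈ ordIdeal d k := fun hp e he => by
    rw [coeff_euler, hp e he, mul_zero]
  have hv₀k : ∀ i, v₀ i ∈ ordIdeal d (k + 1) := by
    intro i
    obtain ⟨k, rfl⟩ := Nat.exists_eq_succ_of_ne_zero hk.ne'
    refine sub_mem ?_ ?_
    · exact ordIdeal_anti (by omega)
        (mul_mem_ordIdeal sqNorm_mem_ordIdeal (pderiv_mem_ordIdeal hr i))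
    · exact ordIdeal_anti (by omega) (mul_mem_ordIdeal (X_mem_ordIdeal i) (heul hr))
  have hv₀t : ∑ i, X i * v₀ i = 0 := by
    have : ∀ i, X i * v₀ i = sqNorm d * (X i * pderiv ℝ i r) - X i * X i * euler r := by
      intro i
      simp only [hv₀]
      ring
    simp only [this, Finset.sum_sub_distrib, ← Finset.mul_sum, ← Finset.sum_mul]
    exact sub_self _
  have hcas : euler (euler r) + ((d : FPS d) - 2) * euler r - C κ * r ∈ ordIdeal d (k + 1) := by
    intro e he
    have h2 : ((d : FPS d) - 2) = C ((d : ℝ) - 2) := by rw [map_sub, map_natCast, map_ofNat]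
    rw [h2, map_sub, map_add, coeff_C_mul, coeff_C_mul, coeff_euler, coeff_euler]
    rcases Nat.lt_succ_iff_lt_or_eq.1 he with h1 | h1
    · simp [hr e h1]
    · rw [h1, hκ]
      ring
  -- A tangential field is orthogonal to the gradient of `|x|²`, so `|x|²` passes through its
  -- divergence.
  have hdivw : divergence (fun i => sqNorm d * w i) = sqNorm d * divergence w := by
    have : ∀ i, pderiv ℝ i (sqNorm d * w i) =
        sqNorm d * pderiv ℝ i (w i) + 2 * (X i * w i) := by
      intro i
      rw [Derivation.leibniz, pderiv_sqNorm, smul_eq_mul, smul_eq_mul]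
      ring
    simp only [divergence, this, Finset.sum_add_distrib, ← Finset.mul_sum, hw0, mul_zero, add_zero]
  -- Modulo `ordIdeal d (k + 1)`, `κ r = |x|² Δr - div v₀` and `|x|² Δr = |x|² (div w + ρ)`; solving
  -- for `r` gives the field and the radial part.
  refine ⟨fun i => C κ⁻¹ * (sqNorm d * w i - v₀ i), fun i =>
    Ideal.mul_mem_left _ _ (sub_mem (hw i) (hv₀k i)), ?_, κ⁻¹ • (sqNorm d * ρ),
    Submodule.smul_mem _ _ (sqNorm_mul_mem_radialSpan hρ), ?_⟩
  · have : ∀ i, X i * (C κ⁻¹ * (sqNorm d * w i - v₀ i)) =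
        C κ⁻¹ * (sqNorm d * (X i * w i) - X i * v₀ i) := fun i => by ring
    simp only [this, ← Finset.mul_sum, Finset.sum_sub_distrib, hw0, hv₀t, mul_zero, sub_zero]
  · have hdiv : divergence (fun i => C κ⁻¹ * (sqNorm d * w i - v₀ i)) =
        C κ⁻¹ * (sqNorm d * divergence w - divergence v₀) := by
      rw [← hdivw, divergence_C_mul_sub]
    have hκC : (C κ⁻¹ : FPS d) * C κ = 1 := by rw [← map_mul, inv_mul_cancel₀ hκ0, map_one]
    have hc := sqNorm_mul_laplacian_sub_divergence r
    have : r - divergence (fun i => C κ⁻¹ * (sqNorm d * w i - v₀ i)) - κ⁻¹ • (sqNorm d * ρ) =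
        C κ⁻¹ * (sqNorm d * (divergence (fun i => pderiv ℝ i r) - divergence w - ρ) -
          (euler (euler r) + ((d : FPS d) - 2) * euler r - C κ * r)) := by
      rw [hdiv, ← hc, smul_eq_C_mul]
      linear_combination -(r * hκC)
    rw [this]
    exact Ideal.mul_mem_left _ _ (sub_mem h hcas)

/-! ### Gaussian integrals of radial series -/

theorem gaussInt_euler (k : ℕ) (p : FPS d) : gaussInt k (euler p) = k * gaussInt k p := by
  rw [gaussInt_apply, gaussInt_apply, Finset.mul_sum]
  refine Finset.sum_congr rfl fun m hm => ?_
  rw [coeff_euler, mem_univ_finsuppAntidiag.1 hm]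
  ring

theorem gaussInt_sqNorm_mul (k : ℕ) (p : FPS d) :
    gaussInt (k + 2) (sqNorm d * p) = (k + d) * gaussInt k p := by
  have h1 : sqNorm d * p = ∑ i, X i * (X i * p) := by
    rw [sqNorm, Finset.sum_mul]
    exact Finset.sum_congr rfl fun i _ => mul_assoc _ _ _
  have h2 : ∀ i : Fin d, pderiv ℝ i (X i * p) = X i * pderiv ℝ i p + p := by
    intro i
    rw [Derivation.leibniz, pderiv_X_self, smul_eq_mul, smul_eq_mul, mul_one]
  simp only [h1, map_sum, gaussInt_X_mul, h2, map_add, Finset.sum_add_distrib]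
  rw [← map_sum, ← euler, gaussInt_euler]
  simp
  ring

theorem gaussInt_sqNorm_pow_pos (hd : 0 < d) (j : ℕ) : 0 < gaussInt (2 * j) (sqNorm d ^ j) := by
  induction j with
  | zero => simpa using gaussInt_zero_one_pos
  | succ j ih =>
    rw [pow_succ', Nat.mul_succ, gaussInt_sqNorm_mul]
    have : (0 : ℝ) < d := by exact_mod_cast hd
    positivity

/-- A limit of radial series is determined by its Gaussian integrals. -/
theorem eq_zero_of_gaussInt_eq_zero (hd : 0 < d) {p : FPS d}
    (hp : ∀ n, ∃ ρ ∈ radialSpan d, p - ρ ∈ ordIdeal d n) (h : ∀ n, gaussInt n p = 0) : p = 0 := by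
  refine eq_zero_of_forall_mem_ordIdeal fun n => ?_
  induction n with
  | zero => exact mem_ordIdeal_zero _
  | succ n ih =>
    obtain ⟨ρ, hρ, hpρ⟩ := hp (n + 1)
    obtain ⟨c, hc⟩ := coeff_of_mem_radialSpan hρ n
    have hpc : ∀ e : Fin d →₀ ℕ, e.degree = n → coeff e p = c * coeff e (sqNorm d ^ (n / 2)) := by
      intro e he
      have := hpρ e (by omega)
      rw [map_sub, sub_eq_zero] at this
      rw [this, hc e he]
    intro e he
    rcases Nat.lt_succ_iff_lt_or_eq.1 he with h1 | h1
    · exact ih e h1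
    rw [hpc e h1]
    by_cases hn : n = 2 * (n / 2)
    · have hg : gaussInt n p = c * gaussInt n (sqNorm d ^ (n / 2)) := by
        rw [gaussInt_apply, gaussInt_apply, Finset.mul_sum]
        refine Finset.sum_congr rfl fun m hm => ?_
        rw [hpc m (mem_univ_finsuppAntidiag.1 hm)]
        ring
      have hpos := gaussInt_sqNorm_pow_pos hd (n / 2)
      rw [← hn] at hpos
      rw [h, eq_comm, mul_eq_zero] at hg
      rw [hg.resolve_right hpos.ne', zero_mul]
    · rw [coeff_sqNorm_pow_eq_zero (h1 ▸ hn), mul_zero]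

/-! ### The normal form `(|x|²/2, radial)` -/

theorem det_sub_det_mem {R n : Type*} [CommRing R] [Fintype n] [DecidableEq n] (I : Ideal R)
    {M N : Matrix n n R} (h : ∀ i j, M i j - N i j ∈ I) : M.det - N.det ∈ I := by
  rw [← Ideal.Quotient.eq, RingHom.map_det, RingHom.map_det]
  congr 1
  exact Matrix.ext fun i j => Ideal.Quotient.eq.2 (h i j)

theorem absSeries_sub_absSeries_mem {k : ℕ} {a a' : FPS d} (h : a - a' ∈ ordIdeal d (k + 1)) :
    Phylon.absSeries a - Phylon.absSeries a' ∈ ordIdeal d (k + 1) := by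
  have h0 : constantCoeff a = constantCoeff a' := by
    have := mem_ordIdeal_one.1 (ordIdeal_anti (Nat.le_add_left 1 k) h)
    rwa [map_sub, sub_eq_zero] at this
  rw [Phylon.absSeries, Phylon.absSeries, h0]
  split_ifs
  · exact h
  · have := neg_mem h
    rwa [neg_sub, ← neg_sub_neg] at this

/-- One degree is lost to the derivatives in the Jacobian. This continuity lets the density pass to
the limit of the normalising changes. -/
theorem pullDensity_sub_pullDensity_mem {k : ℕ} {ψ φ : Phylon d}
    (h : ∀ i, ψ.toFun i - φ.toFun i ∈ ordIdeal d (k + 2)) (b : FPS d) :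
    ψ.pullDensity b - φ.pullDensity b ∈ ordIdeal d (k + 1) := by
  have h1 := ordIdeal_anti (Nat.le_succ _)
    (subst_sub_subst_mem ψ.constantCoeff_toFun φ.constantCoeff_toFun h b)
  have h2 : (jacobian ψ.toFun).det - (jacobian φ.toFun).det ∈ ordIdeal d (k + 1) := by
    refine det_sub_det_mem _ fun i j => ?_
    rw [jacobian, jacobian, Matrix.of_apply, Matrix.of_apply, ← map_sub]
    exact pderiv_mem_ordIdeal (h i) j
  have h3 := absSeries_sub_absSeries_mem h2
  rw [Phylon.pullDensity, Phylon.pullDensity]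
  have := add_mem (Ideal.mul_mem_right (Phylon.absSeries (jacobian ψ.toFun).det) _ h1)
    (Ideal.mul_mem_left _ (subst φ.toFun b) h3)
  convert this using 1
  ring

theorem subst_shear_quadForm_one (j : Fin d) {u : FPS d} (hu : u ∈ ordIdeal d 2) :
    subst (shear j u) (quadForm (1 : Matrix (Fin d) (Fin d) ℝ)) =
      quadForm 1 + X j * u + C (1 / 2 : ℝ) * (u * u) := by
  have h0 := constantCoeff_shear j hu
  have h1 : ∀ i, shear j u i * shear j u i =
      X i * X i + if i = j then 2 * (X j * u) + u * u else 0 := by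
    intro i
    rw [shear]
    split_ifs with h
    · rw [h]
      ring
    · ring
  have h2 : (C (1 / 2 : ℝ) : FPS d) * 2 = 1 := by
    rw [← map_ofNat (C : ℝ →+* FPS d) 2, ← map_mul]
    norm_num
  rw [quadForm_one, subst_mul (hasSubst_of_zero h0), subst_C, sqNorm, subst_finset_sum h0]
  simp only [subst_mul (hasSubst_of_zero h0), subst_X (hasSubst_of_zero h0), h1,
    Finset.sum_add_distrib, Finset.sum_ite_eq', Finset.mem_univ, if_true]
  linear_combination (X j * u) * h2

/-- The leading effect of a shear. -/
theorem shear_leading_terms {k : ℕ} (hk : 1 ≤ k) (j : Fin d) {u : FPS d}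
    (hu : u ∈ ordIdeal d (k + 1)) {f : FPS d} (hf : f - quadForm 1 ∈ ordIdeal d (k + 2))
    (b : FPS d) :
    subst (shear j u) f - (f + X j * u) ∈ ordIdeal d (k + 3) ∧
    subst (shear j u) b * (1 + pderiv ℝ j u) - (b + C (constantCoeff b) * pderiv ℝ j u) ∈
      ordIdeal d (k + 1) := by
  have hu2 : u ∈ ordIdeal d 2 := ordIdeal_anti (by omega) hu
  have h0 := constantCoeff_shear j hu2
  have ht : ∀ {n}, u ∈ ordIdeal d n → ∀ i, shear j u i - X i ∈ ordIdeal d n := by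
    intro n hn i
    rw [shear, add_sub_cancel_left]
    split_ifs
    exacts [hn, zero_mem _]
  constructor
  · have h1 := mem_ordIdeal_iff_le_order.2 (succ_order_le_sub_subst h0
      (fun i => mem_ordIdeal_iff_le_order.1 (ht hu2 i)) _ _ (mem_ordIdeal_iff_le_order.1 hf))
    rw [subst_sub (hasSubst_of_zero h0), subst_shear_quadForm_one j hu2] at h1
    have h2 : C (1 / 2 : ℝ) * (u * u) ∈ ordIdeal d (k + 3) :=
      Ideal.mul_mem_left _ _ (ordIdeal_anti (by omega) (mul_mem_ordIdeal hu hu))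
    convert sub_mem h2 h1 using 1
    ring
  · have h1 := subst_sub_subst_mem h0 constantCoeff_X (ht hu) b
    rw [subst_self, id] at h1
    have h2 := mul_mem_ordIdeal (sub_C_mem_ordIdeal b) (pderiv_mem_ordIdeal hu j)
    rw [add_comm 1 k] at h2
    convert add_mem (Ideal.mul_mem_right (1 + pderiv ℝ j u) _ h1) h2 using 1
    ring

/-- Shears in successive coordinates are composed. Their leading effects add, since each preserves
the order of `f - quadForm 1` and the value `b(0)`, the only data on which the next effect depends.
-/
theorem exists_phylon_leading_terms {k : ℕ} (hk : 1 ≤ k) {u : Fin d → FPS d}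
    (hu : ∀ i, u i ∈ ordIdeal d (k + 1)) {f : FPS d} (hf : f - quadForm 1 ∈ ordIdeal d (k + 2))
    (b : FPS d) (s : Finset (Fin d)) :
    ∃ φ : Phylon d, (∀ i, φ.toFun i - X i ∈ ordIdeal d (k + 1)) ∧
      subst φ.toFun f - (f + ∑ i ∈ s, X i * u i) ∈ ordIdeal d (k + 3) ∧
      φ.pullDensity b - (b + C (constantCoeff b) * ∑ i ∈ s, pderiv ℝ i (u i)) ∈
        ordIdeal d (k + 1) := by
  induction s using Finset.induction_on with
  | empty =>
    refine ⟨1, fun i => ?_, ?_, ?_⟩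
    · rw [Phylon.one_toFun, sub_self]
      exact zero_mem _
    · simp [Phylon.subst_one_toFun]
    · simp [Phylon.pullDensity_one]
  | insert j s hj ih =>
    obtain ⟨φ, hφ, hφf, hφb⟩ := ih
    have hXu : ∑ i ∈ s, X i * u i ∈ ordIdeal d (k + 2) := sum_mem fun i _ =>
      ordIdeal_anti (by omega) (mul_mem_ordIdeal (X_mem_ordIdeal i) (hu i))
    have hf' : subst φ.toFun f - quadForm 1 ∈ ordIdeal d (k + 2) := by
      convert add_mem (add_mem (ordIdeal_anti (by omega) hφf) hf) hXu using 1
      ring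
    have hu2 : u j ∈ ordIdeal d 2 := ordIdeal_anti (by omega) (hu j)
    obtain ⟨h1, h2⟩ := shear_leading_terms hk j (hu j) hf' (φ.pullDensity b)
    have hb0 : constantCoeff (φ.pullDensity b) = constantCoeff b := by
      have h3 := mem_ordIdeal_one.1 (ordIdeal_anti (by omega) hφb)
      have h4 : ∑ i ∈ s, pderiv ℝ i (u i) ∈ ordIdeal d 1 := sum_mem fun i _ =>
        ordIdeal_anti hk (pderiv_mem_ordIdeal (hu i) i)
      rw [map_sub, map_add, map_mul, mem_ordIdeal_one.1 h4, mul_zero, add_zero, sub_eq_zero] at h3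
      exact h3
    have hE : (Phylon.ofShear j (u j) hu2).toFun = shear j (u j) := rfl
    refine ⟨φ * Phylon.ofShear j (u j) hu2, fun i => ?_, ?_, ?_⟩
    · have h3 : subst (shear j (u j)) (φ.toFun i - X i) ∈ ordIdeal d (k + 1) :=
        subst_mem_ordIdeal (constantCoeff_shear j hu2) (hφ i)
      rw [subst_sub (hasSubst_of_zero (constantCoeff_shear j hu2)),
        subst_X (hasSubst_of_zero (constantCoeff_shear j hu2))] at h3
      have h4 : shear j (u j) i - X i ∈ ordIdeal d (k + 1) := by
        rw [shear, add_sub_cancel_left]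
        split_ifs
        exacts [hu j, zero_mem _]
      have := add_mem h3 h4
      rwa [sub_add_sub_cancel] at this
    · rw [Phylon.subst_mul_toFun, hE, Finset.sum_insert hj]
      convert add_mem h1 hφf using 1
      ring
    · rw [Phylon.pullDensity_mul, Phylon.pullDensity_ofShear, Finset.sum_insert hj]
      rw [hb0] at h2
      convert add_mem h2 hφb using 1
      ring

/-- One step of the reduction to the normal form. -/
theorem exists_normal_form_step (hd : 1 < d) {k : ℕ} (hk : 1 ≤ k) {f b : FPS d}
    (hf : f - quadForm 1 ∈ ordIdeal d (k + 2)) (hb0 : constantCoeff b ≠ 0)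
    (hb : ∃ ρ ∈ radialSpan d, b - ρ ∈ ordIdeal d k) :
    ∃ φ : Phylon d, (∀ i, φ.toFun i - X i ∈ ordIdeal d (k + 1)) ∧
      subst φ.toFun f - quadForm 1 ∈ ordIdeal d (k + 3) ∧
      ∃ ρ ∈ radialSpan d, φ.pullDensity b - ρ ∈ ordIdeal d (k + 1) := by
  obtain ⟨ρ, hρ, hbρ⟩ := hb
  set β := constantCoeff b with hβ
  set h := f - quadForm 1 with hh
  -- By Euler's identity this choice makes `∑ xⁱ u₀ⁱ` cancel the degree `k + 2` part of `h`.
  set u₀ : Fin d → FPS d := fun i => C (-((k + 2 : ℕ) : ℝ)⁻¹) * pderiv ℝ i h with hu₀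
  have hu₀k : ∀ i, u₀ i ∈ ordIdeal d (k + 1) := fun i =>
    Ideal.mul_mem_left _ _ (pderiv_mem_ordIdeal hf i)
  have hXu₀ : h + ∑ i, X i * u₀ i ∈ ordIdeal d (k + 3) := by
    have h1 : ∑ i, X i * u₀ i = C (-((k + 2 : ℕ) : ℝ)⁻¹) * euler h := by
      rw [euler, Finset.mul_sum]
      exact Finset.sum_congr rfl fun i _ => by simp only [hu₀]; ring
    intro e he
    rw [h1, map_add, coeff_C_mul, coeff_euler]
    rcases Nat.lt_succ_iff_lt_or_eq.1 he with h2 | h2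
    · simp [hf e h2]
    · rw [h2]
      have : ((k + 2 : ℕ) : ℝ) ≠ 0 := Nat.cast_ne_zero.2 (by omega)
      field_simp
      ring
  obtain ⟨v, hv, hv0, ρ', hρ', hr⟩ := exists_tangential_divergence hd k
    (b - ρ + C β * divergence u₀)
    (add_mem hbρ (Ideal.mul_mem_left _ _ (divergence_mem_ordIdeal hu₀k)))
  -- Subtracting a tangential field leaves `∑ xⁱ uⁱ` unchanged, while `β` times the divergence drops
  -- by `div v`, the nonradial part of the density in degree `k`.
  set u : Fin d → FPS d := fun i => u₀ i - C β⁻¹ * v i with hu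
  have huk : ∀ i, u i ∈ ordIdeal d (k + 1) := fun i =>
    sub_mem (hu₀k i) (Ideal.mul_mem_left _ _ (hv i))
  have hXu : ∑ i, X i * u i = ∑ i, X i * u₀ i := by
    have : ∀ i, X i * u i = X i * u₀ i - C β⁻¹ * (X i * v i) := fun i => by
      simp only [hu]
      ring
    simp only [this, Finset.sum_sub_distrib, ← Finset.mul_sum, hv0, mul_zero, sub_zero]
  have hdu : ∑ i, pderiv ℝ i (u i) = divergence u₀ - C β⁻¹ * divergence v := by
    simp only [hu, divergence, pderiv_C_mul, map_sub, Finset.sum_sub_distrib, ← Finset.mul_sum]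
  have hββ : (C β : FPS d) * C β⁻¹ = 1 := by rw [← map_mul, mul_inv_cancel₀ hb0, map_one]
  obtain ⟨φ, hφ, hφf, hφb⟩ := exists_phylon_leading_terms hk huk hf b Finset.univ
  refine ⟨φ, hφ, ?_, ρ + ρ', add_mem hρ hρ', ?_⟩
  · rw [hXu] at hφf
    convert add_mem hφf hXu₀ using 1
    rw [hh]
    ring
  · rw [hdu, ← hβ] at hφb
    convert add_mem hφb hr using 1
    linear_combination -divergence v * hββ

/-- Step `n` changes nothing below degree `n + 2`, so each coefficient stabilises; the one of degree
`m` can be read off from `Φ m`, and the linear part is that of `Φ 0`. -/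
theorem exists_limit (Φ : ℕ → Phylon d)
    (h : ∀ n i, (Φ (n + 1)).toFun i - (Φ n).toFun i ∈ ordIdeal d (n + 2)) :
    ∃ Ψ : Phylon d, ∀ n i, Ψ.toFun i - (Φ n).toFun i ∈ ordIdeal d (n + 2) := by
  have hmn : ∀ n m i, n ≤ m → (Φ m).toFun i - (Φ n).toFun i ∈ ordIdeal d (n + 2) := by
    intro n m i hnm
    induction m, hnm using Nat.le_induction with
    | base => rw [sub_self]; exact zero_mem _
    | succ m hm ih =>
      have := add_mem (ordIdeal_anti (by omega) (h m i)) ih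
      rwa [sub_add_sub_cancel] at this
  let L : Fin d → FPS d := fun i e => coeff e ((Φ e.degree).toFun i)
  have hL : ∀ i e, coeff e (L i) = coeff e ((Φ e.degree).toFun i) := fun _ _ => rfl
  have hLn : ∀ n i, L i - (Φ n).toFun i ∈ ordIdeal d (n + 2) := by
    intro n i e he
    rw [map_sub, hL, ← map_sub]
    rcases le_total n e.degree with hne | hne
    · exact hmn n _ i hne e he
    · rw [← neg_sub, map_neg, hmn _ n i hne e (by omega), neg_zero]
  refine ⟨⟨L, fun i => ?_, ?_⟩, hLn⟩
  · have := mem_ordIdeal_one.1 (ordIdeal_anti one_le_two (hLn 0 i))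
    rwa [map_sub, (Φ 0).constantCoeff_toFun, sub_zero] at this
  · have : linearPart L = linearPart (Φ 0).toFun := by
      ext i j
      have := hLn 0 i (Finsupp.single j 1) (by rw [Finsupp.degree_single]; norm_num)
      rwa [map_sub, sub_eq_zero] at this
    rw [this]
    exact (Φ 0).isUnit_linearPart

theorem exists_normal_form_of_hessian_eq_one (hd : 1 < d) {f b : FPS d} (hf : f ∈ phaseSpace d)
    (hH : hessian f = 1) (hb : constantCoeff b ≠ 0) :
    ∃ Φ : Phylon d, subst Φ.toFun f = quadForm 1 ∧
      ∀ n, ∃ ρ ∈ radialSpan d, Φ.pullDensity b - ρ ∈ ordIdeal d n := by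
  let good : ℕ → Phylon d → Prop := fun n Φ => subst Φ.toFun f - quadForm 1 ∈ ordIdeal d (n + 3) ∧
    ∃ ρ ∈ radialSpan d, Φ.pullDensity b - ρ ∈ ordIdeal d (n + 1)
  have hstep : ∀ n (Φ : {Φ // good n Φ}), ∃ Φ' : {Φ // good (n + 1) Φ},
      ∀ i, Φ'.1.toFun i - Φ.1.toFun i ∈ ordIdeal d (n + 2) := by
    rintro n ⟨Φ, h1, h2⟩
    obtain ⟨φ, hφ, hφf, hφb⟩ := exists_normal_form_step hd (k := n + 1) (by omega) h1
      (Φ.constantCoeff_pullDensity_ne_zero hb) h2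
    refine ⟨⟨Φ * φ, ?_, ?_⟩, fun i => ?_⟩
    · rw [Phylon.subst_mul_toFun]
      exact hφf
    · rw [Phylon.pullDensity_mul]
      exact hφb
    · have := subst_sub_subst_mem φ.constantCoeff_toFun constantCoeff_X hφ (Φ.toFun i)
      rwa [subst_self] at this
  have h0 : good 0 1 := by
    refine ⟨?_, _, C_mem_radialSpan (constantCoeff b), ?_⟩
    · rw [Phylon.subst_one_toFun, ← hH]
      exact sub_quadForm_mem_ordIdeal hf
    · rw [Phylon.pullDensity_one]
      exact sub_C_mem_ordIdeal b
  choose next hnext using hstep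
  let S : ∀ n, {Φ // good n Φ} := fun n => Nat.rec ⟨1, h0⟩ (fun n Φ => next n Φ) n
  obtain ⟨Ψ, hΨ⟩ := exists_limit (fun n => (S n).1) fun n i => hnext n (S n) i
  refine ⟨Ψ, eq_of_forall_sub_mem_ordIdeal fun n => ?_, fun n => ?_⟩
  · have h1 := subst_sub_subst_mem Ψ.constantCoeff_toFun (S n).1.constantCoeff_toFun (hΨ n) f
    have := add_mem (ordIdeal_anti (k := n) (by omega) h1)
      (ordIdeal_anti (k := n) (by omega) (S n).2.1)
    rwa [sub_add_sub_cancel] at this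
  · obtain ⟨ρ, hρ, h1⟩ := (S n).2.2
    refine ⟨ρ, hρ, ?_⟩
    have := add_mem (pullDensity_sub_pullDensity_mem (hΨ n) b) h1
    rw [sub_add_sub_cancel] at this
    exact ordIdeal_anti (Nat.le_succ n) this

/-- Every pair is equivalent to one of the form `(|x|²/2, b)` with `b` radial. -/
theorem exists_normal_form (hd : 1 < d) {f b : FPS d} (hf : f ∈ phaseSpace d)
    (hb : constantCoeff b ≠ 0) :
    ∃ Φ : Phylon d, subst Φ.toFun f = quadForm 1 ∧
      ∀ n, ∃ ρ ∈ radialSpan d, Φ.pullDensity b - ρ ∈ ordIdeal d n := by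
  obtain ⟨A, hA, hAH⟩ := exists_transpose_mul_mul_eq_one hf.2.2
  have hfA := phaseSpace_and_hessian_subst_linSubst hA hf
  obtain ⟨Φ, h1, h2⟩ := exists_normal_form_of_hessian_eq_one hd hfA.1 (hfA.2.trans hAH)
    ((Phylon.ofMatrix A hA).constantCoeff_pullDensity_ne_zero hb)
  refine ⟨Phylon.ofMatrix A hA * Φ, ?_, fun n => ?_⟩
  · rw [Phylon.subst_mul_toFun]
    exact h1
  · rw [Phylon.pullDensity_mul]
    exact h2 n

/-- With no higher part in the phase, only the term `l = 0` survives. -/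
theorem laplaceCoeff_quadForm_one (b : FPS d) (i : ℕ) :
    laplaceCoeff (quadForm 1) b i = gaussInt i b := by
  rw [laplaceCoeff_eq_gaussLaplace (hessian_quadForm Matrix.isSymm_one), sub_self, gaussLaplace,
    Finset.sum_range_succ']
  simp

end LaplaceExpansion

end

/-! ### The equivalence, by comparison of normal forms -/

open LaplaceExpansion in
theorem theorem1 (d : ℕ) (hd : 1 < d)
    (f : FPS d) (hf : f ∈ phaseSpace d) (b : FPS d) (hb : b ∈ amplitudeSpace d)
    (g : FPS d) (hg : g ∈ phaseSpace d) (c : FPS d) (hc : c ∈ amplitudeSpace d) :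
    (∀ i : ℕ, laplaceCoeff f b i = laplaceCoeff g c i) ↔
      ∃ ψ : Phylon d, (f, b) = (ψ.actFun g, ψ.actDensity c) := by
  constructor
  · intro h
    obtain ⟨Φ, hΦf, hΦb⟩ := exists_normal_form hd hf hb
    obtain ⟨Ψ, hΨg, hΨc⟩ := exists_normal_form hd hg hc
    -- Both normal densities are radial, and by invariance their Gaussian integrals are the given
    -- Laplace coefficients.
    have hbc : Φ.pullDensity b = Ψ.pullDensity c := by
      refine sub_eq_zero.1 (eq_zero_of_gaussInt_eq_zero (by omega) (fun n => ?_) fun n => ?_)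
      · obtain ⟨ρ, hρ, h1⟩ := hΦb n
        obtain ⟨σ, hσ, h2⟩ := hΨc n
        refine ⟨ρ - σ, sub_mem hρ hσ, ?_⟩
        convert sub_mem h1 h2 using 1
        ring
      · rw [map_sub, ← laplaceCoeff_quadForm_one, ← laplaceCoeff_quadForm_one, sub_eq_zero]
        conv_lhs => rw [← hΦf, Φ.laplaceCoeff_pull hf]
        conv_rhs => rw [← hΨg, Ψ.laplaceCoeff_pull hg]
        exact h n
    -- The action pulls back along `(Φ * Ψ⁻¹)⁻¹ = Ψ * Φ⁻¹`: from `(g, c)` to the common normal form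
    -- by `Ψ`, then back to `(f, b)` by `Φ⁻¹`.
    refine ⟨Φ * Ψ⁻¹, Prod.ext ?_ ?_⟩
    · change f = _
      rw [Phylon.actFun_eq, mul_inv_rev, inv_inv, Phylon.subst_mul_toFun, hΨg, ← hΦf,
        ← Phylon.subst_mul_toFun, mul_inv_cancel, Phylon.subst_one_toFun]
    · change b = _
      rw [Phylon.actDensity_eq, mul_inv_rev, inv_inv, Phylon.pullDensity_mul, ← hbc,
        ← Phylon.pullDensity_mul, mul_inv_cancel, Phylon.pullDensity_one]
  · rintro ⟨ψ, h⟩ i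
    obtain ⟨rfl, rfl⟩ := Prod.mk.inj h
    exact Phylon.laplaceCoeff_pull ψ⁻¹ hg c i
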